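/- A tournament is an orientation of a finite complete graph. For a finite loopless digraph $D$ and a vertex $v$, write $\mathrm{ex}_D(v)=d^+_D(v)-d^-_D(v)$ and let $$\mathrm{ex}(D)=\sum_{v\in V(D)}\max\{\mathrm{ex}_D(v),0\}$$ be the excess of $D$. A path decomposition of $D$ is a set of directed paths of $D$, each with at least one edge, whose edge sets partition $E(D)$. The path number $\mathrm{pn}(D)$ is the minimum number of paths in a path decomposition of $D$, and a perfect decomposition of $D$ is a path decomposition of $D$ consisting of exactly $\mathrm{ex}(D)$ paths. **Theorem.** (a) For every real $\gamma>0$ there is $n_0=n_0(\gamma)\in\mathbb{N}$ such that every tournament $T$ on $n\ge n_0$ vertices with $\mathrm{ex}(T)\ge 8n^{17/9+\gamma}$ has a perfect decomposition. (b) There is $n_0\in\mathbb{N}$ such that every tournament $T$ on $n>n_0$ vertices with $n$ even and $\mathrm{ex}(T)\ge n^{2-1/18}$ satisfies $\mathrm{pn}(T)=\mathrm{ex}(T)$. -/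

import Mathlib

universe u

namespace PathDecomp

variable {V : Type u}

/-- The set of directed edges of a digraph. -/
def edgeSet (D : Digraph V) : Set (V × V) := {e | D.Adj e.1 e.2}

/-- A tournament: an orientation of the complete graph, i.e. no loops, and between any two
distinct vertices exactly one of the two possible directed edges. -/
def IsTournament (T : Digraph V) : Prop :=
  (∀ v, ¬ T.Adj v v) ∧ ∀ v w, v ≠ w → Xor (T.Adj v w) (T.Adj w v)

/-- Outdegree. -/
noncomputable def outdeg (D : Digraph V) (v : V) : ℕ := {w | D.Adj v w}.ncard

/-- Indegree. -/
noncomputable def indeg (D : Digraph V) (v : V) : ℕ := {w | D.Adj w v}.ncard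

/-- The excess `d⁺(v) - d⁻(v)` at a vertex, an integer. -/
noncomputable def excessAt (D : Digraph V) (v : V) : ℤ := (outdeg D v : ℤ) - (indeg D v : ℤ)

/-- The excess of a digraph: the sum over all vertices of `max {d⁺(v) - d⁻(v), 0}`. -/
noncomputable def excess [Fintype V] (D : Digraph V) : ℕ := ∑ v, (excessAt D v).toNat

/-- A directed path with at least one edge, given by its sequence of (distinct) vertices;
consecutive vertices are joined by an edge directed forwards. -/
def IsDipath (D : Digraph V) (l : List V) : Prop :=
  2 ≤ l.length ∧ l.Nodup ∧ l.IsChain D.Adj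

/-- The edges of the path with vertex sequence `l`: the pairs of consecutive entries of `l`. -/
def pathEdges (l : List V) : Set (V × V) := {e | [e.1, e.2] <:+: l}

/-- A path decomposition of `D`: a set of directed paths of `D` whose edge sets partition the
edge set of `D`. -/
def IsPathDecomposition (D : Digraph V) (P : Finset (List V)) : Prop :=
  (∀ l ∈ P, IsDipath D l) ∧ (P : Set (List V)).PairwiseDisjoint pathEdges ∧
    ⋃ l ∈ P, pathEdges l = edgeSet D

/-- The path number of `D`: the minimum number of paths in a path decomposition of `D`. -/
noncomputable def pathNumber (D : Digraph V) : ℕ :=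
  sInf {k | ∃ P : Finset (List V), IsPathDecomposition D P ∧ P.card = k}

/-- A perfect decomposition of `D`: a path decomposition of `D` into exactly `ex(D)` paths. -/
def HasPerfectDecomposition [Fintype V] (D : Digraph V) : Prop :=
  ∃ P : Finset (List V), IsPathDecomposition D P ∧ P.card = excess D

/-- The edges of a one-edge path. -/
lemma pathEdges_pair (a b : V) : pathEdges [a, b] = {(a, b)} := by
  ext ⟨x, y⟩
  simp only [pathEdges, Set.mem_ofPred_eq, Set.mem_singleton_iff, Prod.mk.injEq]
  constructor
  · intro h
    have := h.eq_of_length (by simp)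
    simpa using this
  · rintro ⟨rfl, rfl⟩
    exact List.infix_rfl

/-- The minimum defining `pathNumber` is attained: a finite digraph without loops has a path
decomposition (into single edges). -/
lemma exists_isPathDecomposition_card_eq_pathNumber [Fintype V] (D : Digraph V)
    (hD : ∀ v, ¬ D.Adj v v) :
    ∃ P : Finset (List V), IsPathDecomposition D P ∧ P.card = pathNumber D := by
  classical
  refine Nat.sInf_mem (s := {k | ∃ P : Finset (List V), IsPathDecomposition D P ∧ P.card = k})
    ⟨_, (Finset.univ.filter fun e : V × V => D.Adj e.1 e.2).image fun e => [e.1, e.2],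
      ⟨?_, ?_, ?_⟩, rfl⟩
  · intro l hl
    obtain ⟨⟨a, b⟩, he, rfl⟩ := Finset.mem_image.1 hl
    have hab : D.Adj a b := by simpa using he
    have hne : a ≠ b := by
      rintro rfl
      exact hD _ hab
    simp [IsDipath, hne, hab]
  · intro l hl l' hl' hne
    obtain ⟨⟨a, b⟩, -, rfl⟩ := Finset.mem_image.1 hl
    obtain ⟨⟨c, d⟩, -, rfl⟩ := Finset.mem_image.1 hl'
    simp only [Function.onFun, pathEdges_pair, Set.disjoint_singleton]
    rintro h
    apply hne
    simp_all
  · ext ⟨x, y⟩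
    simp only [Set.mem_iUnion, edgeSet, Set.mem_ofPred_eq]
    constructor
    · rintro ⟨l, hl, h⟩
      obtain ⟨⟨a, b⟩, he, rfl⟩ := Finset.mem_image.1 hl
      rw [pathEdges_pair] at h
      obtain ⟨rfl, rfl⟩ : x = a ∧ y = b := by simpa using h
      simpa using he
    · intro h
      exact ⟨[x, y], Finset.mem_image.2 ⟨(x, y), by simpa using h, rfl⟩, by
        rw [pathEdges_pair]; rfl⟩

end PathDecomp

/-!
If no vertex is both the start of one path and the end of another, then exactly `max {ex(v), 0}`
paths of a decomposition start at each vertex `v`, so the decomposition is perfect. Coincidences of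
a start with an end are removed by absorbers: arc-disjoint short paths through prescribed centres,
each from a vertex of large surplus to one of large deficit. Given a path ending at `x` and a path
starting at `x`, cutting an absorber with centre `x` there and joining its halves to the two paths
uses the same arcs and destroys one coincidence at `x`. A tournament of large excess has many such
vertices, and as long as a set avoids all vertices of large surplus its in-neighbourhood contains
about half of the remaining vertices, so absorbers of logarithmic length exist greedily.

The remaining arcs have to be split so that there are few coincidences at each vertex. Colour the
vertices randomly with `ℤ/p`, where `p` is an odd prime. For `d ≠ 0`, the arcs along which the
colour increases by `d`, apart from those starting in colour `d`, form an acyclic digraph whose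
paths have at most `p` vertices, and which can be decomposed without coincidences. Each vertex of
a typical colouring sees all colours about equally often in each direction, up to `√n` and
logarithmic factors, so in the union it is the end, or else the start, of only about `p√n + n/p`
paths. With `p` about `n^(1/4)` this needs `k` about `n^(3/4)` absorbers at each centre; they can be
spread so that each vertex lies on about `√(kn)`, that is `n^(7/8)`, of them, and a total excess of
`n · n^(7/8)` up to logarithmic factors suffices.
-/

namespace PathDecomp

open Finset Function

variable {V : Type u}

section Arcs

/-- The arcs of the path with vertex sequence `l`, in the order in which the path uses them. -/
def arcs (l : List V) : List (V × V) := l.consecutivePairs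

@[simp] lemma arcs_nil : arcs ([] : List V) = [] := rfl

@[simp] lemma arcs_singleton (a : V) : arcs [a] = [] := rfl

@[simp] lemma arcs_cons_cons (a b : V) (l : List V) :
    arcs (a :: b :: l) = (a, b) :: arcs (b :: l) := rfl

lemma arcs_append_cons (l l' : List V) (x : V) :
    arcs (l ++ x :: l') = arcs (l ++ [x]) ++ arcs (x :: l') := by
  induction l with
  | nil => simp
  | cons a l ih => cases l <;> simp_all

lemma mem_arcs_iff_infix {a b : V} {l : List V} : (a, b) ∈ arcs l ↔ [a, b] <:+: l := by
  induction l with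
  | nil => simp
  | cons c l ih =>
    cases l with
    | nil => simpa using fun h : [a, b] <:+: [c] => by simpa using h.length_le
    | cons d l =>
      rw [arcs_cons_cons, List.mem_cons, ih, List.infix_cons_iff (l₂ := d :: l)]
      simp

lemma pathEdges_eq_arcs (l : List V) : pathEdges l = {e | e ∈ arcs l} := by
  ext ⟨a, b⟩
  exact mem_arcs_iff_infix.symm

lemma isChain_iff_forall_mem_arcs {r : V → V → Prop} {l : List V} :
    l.IsChain r ↔ ∀ e ∈ arcs l, r e.1 e.2 := by
  induction l with
  | nil => simp
  | cons c l ih => cases l <;> simp_all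

lemma arcs_ne_nil {l : List V} (hl : 2 ≤ l.length) : arcs l ≠ [] := by
  match l, hl with
  | a :: b :: l, _ => simp

lemma map_snd_arcs (l : List V) : (arcs l).map Prod.snd = l.tail :=
  List.map_snd_zip (by simp)

lemma nodup_arcs {l : List V} (hl : l.Nodup) : (arcs l).Nodup :=
  .of_map Prod.snd (map_snd_arcs l ▸ hl.tail)

variable [DecidableEq V]

lemma countP_fst_arcs_add (l : List V) (v : V) :
    (arcs l).countP (fun e => e.1 = v) + (if l.getLast? = some v then 1 else 0) = l.count v := by
  induction l with
  | nil => simp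
  | cons c l ih =>
    cases l with
    | nil => simp [List.count_cons]
    | cons d l =>
      rw [arcs_cons_cons, List.countP_cons, List.count_cons, ← ih, List.getLast?_cons_cons]
      simp only [decide_eq_true_eq, beq_iff_eq]
      omega

lemma countP_snd_arcs_add (l : List V) (v : V) :
    (arcs l).countP (fun e => e.2 = v) + (if l.head? = some v then 1 else 0) = l.count v := by
  cases l with
  | nil => simp
  | cons a l =>
    have := congrArg (List.count v) (map_snd_arcs (a :: l))
    rw [List.count, List.countP_map] at this
    simp_all [List.count, List.countP_cons, Function.comp_def, beq_eq_decide]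

end Arcs

section Families

/-- The arcs of a family of paths, with multiplicity. -/
def arcsOf (P : Multiset (List V)) : Multiset (V × V) := P.bind fun l => ↑(arcs l)

@[simp] lemma arcsOf_zero : arcsOf (0 : Multiset (List V)) = 0 := rfl

@[simp] lemma arcsOf_cons (l : List V) (P : Multiset (List V)) :
    arcsOf (l ::ₘ P) = arcs l + arcsOf P := Multiset.cons_bind ..

@[simp] lemma arcsOf_add (P Q : Multiset (List V)) : arcsOf (P + Q) = arcsOf P + arcsOf Q :=
  Multiset.add_bind ..

lemma mem_arcsOf {e : V × V} {P : Multiset (List V)} : e ∈ arcsOf P ↔ ∃ l ∈ P, e ∈ arcs l := by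
  simp [arcsOf]

/-- `Decomposes P E` says that the paths of the family `P` have distinct vertices and at least one
arc each, and that together they use exactly the arcs in `E`. Both `P` and `E` are multisets, so
that families can be added. -/
structure Decomposes (P : Multiset (List V)) (E : Multiset (V × V)) : Prop where
  two_le_length : ∀ l ∈ P, 2 ≤ l.length
  nodup : ∀ l ∈ P, l.Nodup
  arcsOf_eq : arcsOf P = E

lemma Decomposes.add {P Q : Multiset (List V)} {E F : Multiset (V × V)} (hP : Decomposes P E)
    (hQ : Decomposes Q F) : Decomposes (P + Q) (E + F) where
  two_le_length l hl := (Multiset.mem_add.1 hl).elim (hP.1 l) (hQ.1 l)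
  nodup l hl := (Multiset.mem_add.1 hl).elim (hP.2 l) (hQ.2 l)
  arcsOf_eq := by rw [arcsOf_add, hP.3, hQ.3]

lemma Decomposes.ne_nil {P : Multiset (List V)} {E : Multiset (V × V)} (h : Decomposes P E) :
    ∀ l ∈ P, l ≠ [] := by
  rintro _ hl rfl
  simpa using h.two_le_length _ hl

lemma arcsOf_map_pair (E : Multiset (V × V)) : arcsOf (E.map fun e => [e.1, e.2]) = E := by
  simpa [arcsOf, Multiset.bind_map] using Multiset.bind_singleton E id

lemma decomposes_map_pair {E : Multiset (V × V)} (hE : ∀ e ∈ E, e.1 ≠ e.2) :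
    Decomposes (E.map fun e => [e.1, e.2]) E where
  two_le_length := Multiset.forall_mem_map_iff.2 fun _ _ => le_rfl
  nodup := Multiset.forall_mem_map_iff.2 fun e he => by simpa using hE e he
  arcsOf_eq := arcsOf_map_pair E

variable [DecidableEq V]

/-- The number of members of the family `P` that start at `v`. -/
def startsAt (P : Multiset (List V)) (v : V) : ℕ := P.countP fun l => l.head? = some v

/-- The number of members of the family `P` that end at `v`. -/
def endsAt (P : Multiset (List V)) (v : V) : ℕ := P.countP fun l => l.getLast? = some v

/-- The number of arcs in `E` with tail `v`. -/
def outCount (E : Multiset (V × V)) (v : V) : ℕ := E.countP fun e => e.1 = v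

/-- The number of arcs in `E` with head `v`. -/
def inCount (E : Multiset (V × V)) (v : V) : ℕ := E.countP fun e => e.2 = v

@[simp] lemma startsAt_zero (v : V) : startsAt 0 v = 0 := rfl

@[simp] lemma startsAt_cons (l : List V) (P : Multiset (List V)) (v : V) :
    startsAt (l ::ₘ P) v = startsAt P v + if l.head? = some v then 1 else 0 :=
  Multiset.countP_cons ..

@[simp] lemma endsAt_cons (l : List V) (P : Multiset (List V)) (v : V) :
    endsAt (l ::ₘ P) v = endsAt P v + if l.getLast? = some v then 1 else 0 :=
  Multiset.countP_cons ..

@[simp] lemma startsAt_add (P Q : Multiset (List V)) (v : V) :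
    startsAt (P + Q) v = startsAt P v + startsAt Q v := Multiset.countP_add ..

@[simp] lemma endsAt_add (P Q : Multiset (List V)) (v : V) :
    endsAt (P + Q) v = endsAt P v + endsAt Q v := Multiset.countP_add ..

@[simp] lemma outCount_add (E F : Multiset (V × V)) (v : V) :
    outCount (E + F) v = outCount E v + outCount F v := Multiset.countP_add ..

@[simp] lemma inCount_add (E F : Multiset (V × V)) (v : V) :
    inCount (E + F) v = inCount E v + inCount F v := Multiset.countP_add ..

lemma startsAt_pos {P : Multiset (List V)} {v : V} :
    0 < startsAt P v ↔ ∃ l ∈ P, l.head? = some v := Multiset.countP_pos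

lemma endsAt_pos {P : Multiset (List V)} {v : V} :
    0 < endsAt P v ↔ ∃ l ∈ P, l.getLast? = some v := Multiset.countP_pos

lemma startsAt_map_pair (E : Multiset (V × V)) (v : V) :
    startsAt (E.map fun e => [e.1, e.2]) v = outCount E v := by
  simp only [startsAt, Multiset.countP_map]
  simp [outCount, Multiset.countP_eq_card_filter]

lemma endsAt_map_pair (E : Multiset (V × V)) (v : V) :
    endsAt (E.map fun e => [e.1, e.2]) v = inCount E v := by
  simp only [endsAt, Multiset.countP_map]
  simp [inCount, Multiset.countP_eq_card_filter]

lemma outCount_arcsOf_add_endsAt (P : Multiset (List V)) (v : V) :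
    outCount (arcsOf P) v + endsAt P v = (P.map (List.count v)).sum := by
  induction P using Multiset.induction_on with
  | empty => rfl
  | cons l P ih =>
    have hl := countP_fst_arcs_add l v
    simp only [arcsOf_cons, outCount_add, endsAt_cons, Multiset.map_cons, Multiset.sum_cons]
    simp only [outCount, Multiset.coe_countP] at ih ⊢
    omega

lemma inCount_arcsOf_add_startsAt (P : Multiset (List V)) (v : V) :
    inCount (arcsOf P) v + startsAt P v = (P.map (List.count v)).sum := by
  induction P using Multiset.induction_on with
  | empty => rfl
  | cons l P ih =>
    have hl := countP_snd_arcs_add l v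
    simp only [arcsOf_cons, inCount_add, startsAt_cons, Multiset.map_cons, Multiset.sum_cons]
    simp only [inCount, Multiset.coe_countP] at ih ⊢
    omega

lemma card_eq_sum_startsAt [Fintype V] {P : Multiset (List V)} (hP : ∀ l ∈ P, l ≠ []) :
    P.card = ∑ v, startsAt P v := by
  induction P using Multiset.induction_on with
  | empty => simp
  | cons l P ih =>
    obtain ⟨a, l, rfl⟩ := List.exists_cons_of_ne_nil (hP l (by simp))
    simp [ih fun l hl => hP l (Multiset.mem_cons_of_mem hl), sum_add_distrib]

namespace Decomposes

variable {P : Multiset (List V)} {E : Multiset (V × V)}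

lemma outCount_add_endsAt (h : Decomposes P E) (v : V) :
    outCount E v + endsAt P v = inCount E v + startsAt P v := by
  rw [← h.arcsOf_eq, outCount_arcsOf_add_endsAt, inCount_arcsOf_add_startsAt]

lemma sum_count_eq (h : Decomposes P E) (v : V) :
    (P.map (List.count v)).sum = P.countP (v ∈ ·) := by
  have hcount : ∀ l ∈ P, l.count v = if v ∈ l then 1 else 0 := fun l hl => (h.nodup l hl).count
  rw [Multiset.map_congr rfl hcount]
  clear h hcount
  induction P using Multiset.induction_on with
  | empty => simp
  | cons l P ih => simp [ih, Multiset.countP_cons, add_comm]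

lemma outCount_le (h : Decomposes P E) (v : V) : outCount E v ≤ P.countP (v ∈ ·) := by
  have := outCount_arcsOf_add_endsAt P v
  rw [h.arcsOf_eq, h.sum_count_eq] at this
  omega

lemma inCount_le (h : Decomposes P E) (v : V) : inCount E v ≤ P.countP (v ∈ ·) := by
  have := inCount_arcsOf_add_startsAt P v
  rw [h.arcsOf_eq, h.sum_count_eq] at this
  omega

end Decomposes

end Families

section Digraph

variable [Fintype V]

open scoped Classical in
/-- The arcs of the digraph `D` as a finset. -/
noncomputable def arcFinset (D : Digraph V) : Finset (V × V) := {e | D.Adj e.1 e.2}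

@[simp] lemma mem_arcFinset {D : Digraph V} {e : V × V} :
    e ∈ arcFinset D ↔ D.Adj e.1 e.2 := by simp [arcFinset]

lemma IsPathDecomposition.decomposes {D : Digraph V} {P : Finset (List V)}
    (hP : IsPathDecomposition D P) : Decomposes P.val (arcFinset D).val where
  two_le_length l hl := (hP.1 l hl).1
  nodup l hl := (hP.1 l hl).2.1
  arcsOf_eq := by
    have hdisjoint : P.val.Pairwise (Disjoint on fun l => (arcs l : Multiset (V × V))) := by
      refine Multiset.Nodup.pairwise (fun l hl l' hl' hne => ?_) P.nodup
      simpa [pathEdges_eq_arcs, Function.onFun, Set.disjoint_left, Multiset.disjoint_left]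
        using hP.2.1 hl hl' hne
    have hnodup : (arcsOf P.val).Nodup :=
      Multiset.nodup_bind.2 ⟨fun l hl => nodup_arcs (hP.1 l hl).2.1, hdisjoint⟩
    refine (Multiset.Nodup.ext hnodup (arcFinset D).nodup).2 fun e => ?_
    simpa [mem_arcsOf, pathEdges_eq_arcs, edgeSet] using Set.ext_iff.1 hP.2.2 e

lemma Decomposes.exists_isPathDecomposition {D : Digraph V} {P : Multiset (List V)}
    (hP : Decomposes P (arcFinset D).val) :
    ∃ Q : Finset (List V), IsPathDecomposition D Q ∧ Q.val = P := by
  have hnodup : (arcsOf P).Nodup := hP.arcsOf_eq ▸ (arcFinset D).nodup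
  have hdisjoint := (Multiset.nodup_bind.1 hnodup).2
  have hmem (e : V × V) : D.Adj e.1 e.2 ↔ ∃ l ∈ P, e ∈ arcs l := by
    rw [← mem_arcsOf, hP.arcsOf_eq, mem_val, mem_arcFinset]
  have hP_nodup : P.Nodup := by
    obtain ⟨L, rfl, hL⟩ := hdisjoint
    refine hL.imp_of_mem fun {l _} hl _ hdisj heq => ?_
    subst heq
    exact arcs_ne_nil (hP.two_le_length l hl) (by simpa [Function.onFun] using hdisj)
  refine ⟨⟨P, hP_nodup⟩, ⟨fun l hl => ⟨hP.two_le_length l hl, hP.nodup l hl, ?_⟩, ?_, ?_⟩, rfl⟩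
  · exact isChain_iff_forall_mem_arcs.2 fun e he => (hmem e).2 ⟨l, hl, he⟩
  · intro l hl l' hl' hne
    have : Std.Symm (Disjoint on fun l : List V => (arcs l : Multiset (V × V))) :=
      ⟨fun _ _ h => Disjoint.symm (α := Multiset (V × V)) h⟩
    simpa [pathEdges_eq_arcs, Function.onFun, Set.disjoint_left, Multiset.disjoint_left]
      using hdisjoint.forall hl hl' hne
  · ext e
    simp [pathEdges_eq_arcs, edgeSet, hmem]

section

variable [DecidableEq V]

lemma outCount_eq_card (E : Finset (V × V)) (v : V) : outCount E.val v = #{w | (v, w) ∈ E} := by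
  rw [outCount, Multiset.countP_eq_card_filter, ← filter_val, card_val,
    ← card_map (.sectR v V)]
  congr 1
  ext ⟨a, b⟩
  aesop

lemma inCount_eq_card (E : Finset (V × V)) (v : V) : inCount E.val v = #{w | (w, v) ∈ E} := by
  rw [inCount, Multiset.countP_eq_card_filter, ← filter_val, card_val,
    ← card_map (.sectL V v)]
  congr 1
  ext ⟨a, b⟩
  aesop

lemma outdeg_eq_outCount (D : Digraph V) (v : V) :
    outdeg D v = outCount (arcFinset D).val v := by
  simp [outCount_eq_card, outdeg, ← Set.ncard_coe_finset]

lemma indeg_eq_inCount (D : Digraph V) (v : V) :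
    indeg D v = inCount (arcFinset D).val v := by
  simp [inCount_eq_card, indeg, ← Set.ncard_coe_finset]

lemma Decomposes.excessAt_eq {D : Digraph V} {P : Multiset (List V)}
    (hP : Decomposes P (arcFinset D).val) (v : V) :
    excessAt D v = startsAt P v - endsAt P v := by
  have := hP.outCount_add_endsAt v
  rw [excessAt, outdeg_eq_outCount, indeg_eq_inCount]
  omega

lemma Decomposes.hasPerfectDecomposition {D : Digraph V} {P : Multiset (List V)}
    (hP : Decomposes P (arcFinset D).val) (hstart_end : ∀ v, startsAt P v = 0 ∨ endsAt P v = 0) :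
    HasPerfectDecomposition D := by
  obtain ⟨Q, hQ, rfl⟩ := hP.exists_isPathDecomposition
  refine ⟨Q, hQ, ?_⟩
  rw [card_def, card_eq_sum_startsAt hP.ne_nil, excess]
  refine sum_congr rfl fun v _ => ?_
  have := hP.excessAt_eq v
  have := hstart_end v
  omega

end

lemma excess_le_card {D : Digraph V} {P : Finset (List V)} (hP : IsPathDecomposition D P) :
    excess D ≤ #P := by
  classical
  have hdec := IsPathDecomposition.decomposes hP
  rw [card_def, card_eq_sum_startsAt hdec.ne_nil, excess]
  refine sum_le_sum fun v _ => ?_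
  have := hdec.excessAt_eq v
  omega

lemma pathNumber_eq_excess {D : Digraph V} (hD : ∀ v, ¬ D.Adj v v)
    (h : HasPerfectDecomposition D) : pathNumber D = excess D := by
  obtain ⟨Q, hQ, hcard⟩ := exists_isPathDecomposition_card_eq_pathNumber D hD
  exact (Nat.sInf_le h).antisymm ((excess_le_card hQ).trans_eq hcard)

end Digraph

section Acyclic

lemma head?_ne_getLast? {l : List V} (hlen : 2 ≤ l.length) (hl : l.Nodup) :
    l.head? ≠ l.getLast? := by
  match l, hlen with
  | a :: b :: l, _ =>
    rw [List.getLast?_cons_cons, List.head?_cons]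
    exact fun h => (List.nodup_cons.1 hl).1 (List.mem_of_getLast? h.symm)

variable [DecidableEq V] {α : Type*} [Preorder α] {ρ : V → α}

lemma Decomposes.exists_card_lt {P : Multiset (List V)} {E : Multiset (V × V)} {v : V}
    (hP : Decomposes P E) (hrank : ∀ l ∈ P, l.Pairwise (ρ · < ρ ·)) (hstart : 0 < startsAt P v)
    (hend : 0 < endsAt P v) :
    ∃ Q, (Decomposes Q E ∧ ∀ l ∈ Q, l.Pairwise (ρ · < ρ ·)) ∧ Q.card < P.card := by
  obtain ⟨a, ha, ha_last⟩ := endsAt_pos.1 hend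
  obtain ⟨b, hb, hb_head⟩ := startsAt_pos.1 hstart
  have hba : b ≠ a := by
    rintro rfl
    exact head?_ne_getLast? (hP.two_le_length b hb) (hP.nodup b hb) (hb_head.trans ha_last.symm)
  obtain ⟨a, rfl⟩ := List.getLast?_eq_some_iff.1 ha_last
  obtain ⟨b, rfl⟩ := List.head?_eq_some_iff.1 hb_head
  obtain ⟨P, rfl⟩ := Multiset.exists_cons_of_mem ha
  obtain ⟨P, rfl⟩ := Multiset.exists_cons_of_mem ((Multiset.mem_cons.1 hb).resolve_left hba)
  have hmerge : (a ++ v :: b).Pairwise (ρ · < ρ ·) := by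
    have : IsTrans V (ρ · < ρ ·) := ⟨fun _ _ _ => lt_trans⟩
    rw [← List.isChain_iff_pairwise, List.isChain_split]
    exact ⟨(hrank _ ha).isChain, (hrank _ hb).isChain⟩
  have hQ : ∀ l ∈ (a ++ v :: b) ::ₘ P, 2 ≤ l.length ∧ l.Pairwise (ρ · < ρ ·) := by
    refine Multiset.forall_mem_cons.2 ⟨⟨?_, hmerge⟩, fun l hl => ⟨hP.1 l ?_, hrank l ?_⟩⟩
    · have := hP.two_le_length _ hb
      simp only [List.length_append, List.length_cons] at this ⊢
      omega
    all_goals simp [hl]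
  refine ⟨(a ++ v :: b) ::ₘ P, ⟨⟨fun l hl => (hQ l hl).1, fun l hl => ?_, ?_⟩,
    fun l hl => (hQ l hl).2⟩, by simp⟩
  · exact (hQ l hl).2.imp fun h => ne_of_apply_ne ρ h.ne
  · rw [← hP.arcsOf_eq, arcsOf_cons, arcsOf_cons, arcsOf_cons, arcs_append_cons,
      ← Multiset.coe_add, add_assoc]

lemma exists_decomposes_of_rank {E : Multiset (V × V)} (hρ : ∀ e ∈ E, ρ e.1 < ρ e.2) :
    ∃ P, Decomposes P E ∧ (∀ l ∈ P, l.Pairwise (ρ · < ρ ·)) ∧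
      ∀ v, startsAt P v = 0 ∨ endsAt P v = 0 := by
  have hex : ∃ P, Decomposes P E ∧ ∀ l ∈ P, l.Pairwise (ρ · < ρ ·) :=
    ⟨E.map fun e => [e.1, e.2], decomposes_map_pair fun e he => ne_of_apply_ne ρ (hρ e he).ne,
      Multiset.forall_mem_map_iff.2 fun e he => by simpa using hρ e he⟩
  obtain ⟨P, ⟨hP, hrank⟩, hmin⟩ := exists_minimalFor_of_wellFoundedLT _ Multiset.card hex
  refine ⟨P, hP, hrank, fun v => ?_⟩
  by_contra! hv
  obtain ⟨Q, hQ, hlt⟩ :=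
    hP.exists_card_lt hrank (Nat.pos_of_ne_zero hv.1) (Nat.pos_of_ne_zero hv.2)
  exact hlt.not_ge (hmin hQ hlt.le)

end Acyclic

section Absorption

/-- An absorber is a path `before ++ centre :: after` with a distinguished vertex, at which it can
be cut in order to extend two other paths. -/
structure Absorber (V : Type*) where
  /-- The vertices of the path before its centre. -/
  before : List V
  /-- The vertex at which the path can be cut. -/
  centre : V
  /-- The vertices of the path after its centre. -/
  after : List V

/-- The path underlying an absorber. -/
def Absorber.path (a : Absorber V) : List V := a.before ++ a.centre :: a.after

/-- The path `l` starts in `S`. -/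
def StartsIn (S : Finset V) (l : List V) : Prop := ∃ s ∈ S, l.head? = some s

/-- The path `l` ends in `R`. -/
def EndsIn (R : Finset V) (l : List V) : Prop := ∃ r ∈ R, l.getLast? = some r

/-- An `(S, R)`-absorber is a path from `S` to `R` whose part before (after) the centre has at most
`L` vertices, and none if the centre lies in `S` (in `R`). -/
structure IsAbsorber (S R : Finset V) (L : ℕ) (a : Absorber V) : Prop where
  nodup : a.path.Nodup
  startsIn : StartsIn S a.path
  endsIn : EndsIn R a.path
  length_before_le : a.before.length ≤ L
  length_after_le : a.after.length ≤ L
  before_eq_nil : a.centre ∈ S → a.before = []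
  after_eq_nil : a.centre ∈ R → a.after = []

open scoped Classical in
/-- The length to which the path `l` can grow if it is extended by at most `L` vertices at the
start unless it already starts in `S`, and at the end unless it already ends in `R`. -/
noncomputable def potential (S R : Finset V) (L : ℕ) (l : List V) : ℕ :=
  l.length + (if StartsIn S l then 0 else L) + (if EndsIn R l then 0 else L)

/-- The family of paths underlying a set of absorbers. -/
def absorberPaths (𝒜 : Finset (Absorber V)) : Multiset (List V) := 𝒜.val.map Absorber.path

lemma head?_append_cons (l l' : List V) (x : V) :
    (l ++ x :: l').head? = (l ++ [x]).head? := by cases l <;> rfl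

lemma nodup_append_cons {l l' : List V} {x : V} (hl : (l ++ [x]).Nodup) (hl' : (x :: l').Nodup)
    (hdisj : l.Disjoint l') : (l ++ x :: l').Nodup := by
  simp_all [List.nodup_append']

lemma length_le_potential (S R : Finset V) (L : ℕ) (l : List V) :
    l.length ≤ potential S R L l := by
  rw [potential]
  omega

variable {S R : Finset V} {L : ℕ} {a : Absorber V}

namespace IsAbsorber

lemma two_le_length (ha : IsAbsorber S R L a) (hSR : Disjoint S R) : 2 ≤ a.path.length := by
  obtain ⟨s, hs, hhead⟩ := ha.startsIn
  obtain ⟨r, hr, hlast⟩ := ha.endsIn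
  have hsr : s ≠ r := disjoint_iff_ne.1 hSR s hs r hr
  match h : a.path with
  | [] => simp [h] at hhead
  | [x] => simp_all
  | _ :: _ :: _ => simp

lemma potential_append_le (ha : IsAbsorber S R L a) (l : List V) :
    potential S R L (l ++ a.centre :: a.after) ≤ potential S R L (l ++ [a.centre]) := by
  classical
  by_cases hR : a.centre ∈ R
  · rw [ha.after_eq_nil hR]
  have hends : EndsIn R (l ++ a.centre :: a.after) := by
    simpa only [EndsIn, Absorber.path, List.getLast?_append_cons] using ha.endsIn
  have hnot : ¬ EndsIn R (l ++ [a.centre]) := by simpa [EndsIn] using hR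
  have hstarts : StartsIn S (l ++ a.centre :: a.after) ↔ StartsIn S (l ++ [a.centre]) := by
    rw [StartsIn, head?_append_cons, StartsIn]
  have hlength := ha.length_after_le
  rw [potential, potential, if_pos hends, if_neg hnot, if_congr hstarts rfl rfl]
  simp only [List.length_append, List.length_cons, List.length_nil]
  omega

lemma potential_before_append_le (ha : IsAbsorber S R L a) (l : List V) :
    potential S R L (a.before ++ a.centre :: l) ≤ potential S R L (a.centre :: l) := by
  classical
  by_cases hS : a.centre ∈ S
  · simp [ha.before_eq_nil hS]
  have hstarts : StartsIn S (a.before ++ a.centre :: l) := by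
    simpa only [StartsIn, Absorber.path, head?_append_cons a.before] using ha.startsIn
  have hnot : ¬ StartsIn S (a.centre :: l) := by simpa [StartsIn] using hS
  have hends : EndsIn R (a.before ++ a.centre :: l) ↔ EndsIn R (a.centre :: l) := by
    rw [EndsIn, List.getLast?_append_cons, EndsIn]
  have hlength := ha.length_before_le
  rw [potential, potential, if_pos hstarts, if_neg hnot, if_congr hends rfl rfl]
  simp only [List.length_append, List.length_cons]
  omega

end IsAbsorber

lemma decomposes_absorberPaths (hSR : Disjoint S R) {𝒜 : Finset (Absorber V)}
    (h𝒜 : ∀ a ∈ 𝒜, IsAbsorber S R L a) :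
    Decomposes (absorberPaths 𝒜) (arcsOf (absorberPaths 𝒜)) where
  two_le_length := Multiset.forall_mem_map_iff.2 fun a ha => (h𝒜 a ha).two_le_length hSR
  nodup := Multiset.forall_mem_map_iff.2 fun a ha => (h𝒜 a ha).nodup
  arcsOf_eq := rfl

section Exchange

variable (l l' a b : List V) (x : V) (Q : Multiset (List V))

lemma arcsOf_exchange :
    arcsOf ((l ++ x :: b) ::ₘ (a ++ x :: l') ::ₘ Q) =
      arcsOf ((l ++ [x]) ::ₘ (x :: l') ::ₘ (a ++ x :: b) ::ₘ Q) := by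
  simp only [arcsOf_cons]
  rw [arcs_append_cons l b, arcs_append_cons a l', arcs_append_cons a b]
  simp only [← Multiset.coe_add]
  abel

variable [DecidableEq V]

lemma startsAt_exchange (v : V) :
    startsAt ((l ++ [x]) ::ₘ (x :: l') ::ₘ (a ++ x :: b) ::ₘ Q) v =
      startsAt ((l ++ x :: b) ::ₘ (a ++ x :: l') ::ₘ Q) v + if x = v then 1 else 0 := by
  simp only [startsAt_cons, head?_append_cons l b, head?_append_cons a, List.head?_cons,
    Option.some.injEq]
  omega

lemma endsAt_exchange (v : V) :
    endsAt ((l ++ [x]) ::ₘ (x :: l') ::ₘ (a ++ x :: b) ::ₘ Q) v =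
      endsAt ((l ++ x :: b) ::ₘ (a ++ x :: l') ::ₘ Q) v + if x = v then 1 else 0 := by
  simp only [endsAt_cons, List.getLast?_append_cons, List.getLast?_singleton, Option.some.injEq]
  omega

end Exchange

namespace IsAbsorber

variable [DecidableEq V] {l l' : List V} {Q : Multiset (List V)} {x : V}

lemma startsAt_exchange_pos (ha : IsAbsorber S R L a) (hx : x ∈ S)
    (hpos : 0 < startsAt ((l ++ [a.centre]) ::ₘ (a.centre :: l') ::ₘ Q) x) :
    0 < startsAt ((l ++ a.centre :: a.after) ::ₘ (a.before ++ a.centre :: l') ::ₘ Q) x := by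
  simp only [startsAt_cons, head?_append_cons l a.after, List.head?_cons,
    Option.some.injEq] at hpos ⊢
  by_cases hax : a.centre = x
  · simp [ha.before_eq_nil (hax ▸ hx), hax]
  · simp only [hax, if_false] at hpos ⊢
    omega

lemma endsAt_exchange_pos (ha : IsAbsorber S R L a) (hx : x ∈ R)
    (hpos : 0 < endsAt ((l ++ [a.centre]) ::ₘ (a.centre :: l') ::ₘ Q) x) :
    0 < endsAt ((l ++ a.centre :: a.after) ::ₘ (a.before ++ a.centre :: l') ::ₘ Q) x := by
  simp only [endsAt_cons, List.getLast?_append_cons l, List.getLast?_append_cons a.before,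
    List.getLast?_singleton, Option.some.injEq] at hpos ⊢
  by_cases hax : a.centre = x
  · simp [ha.after_eq_nil (hax ▸ hx), hax]
  · simp only [hax, if_false] at hpos ⊢
    omega

end IsAbsorber

lemma absorberPaths_eq_cons_erase [DecidableEq (Absorber V)] {𝒜 : Finset (Absorber V)}
    (ha : a ∈ 𝒜) : absorberPaths 𝒜 = a.path ::ₘ absorberPaths (𝒜.erase a) := by
  rw [absorberPaths, absorberPaths, erase_val, ← Multiset.map_cons,
    Multiset.cons_erase (mem_def.1 ha)]

lemma cons_cons_add_absorberPaths [DecidableEq (Absorber V)] {𝒜 : Finset (Absorber V)}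
    (ha : a ∈ 𝒜) (l l' : List V) (Q : Multiset (List V)) :
    l ::ₘ l' ::ₘ Q + absorberPaths 𝒜 =
      l ::ₘ l' ::ₘ a.path ::ₘ (Q + absorberPaths (𝒜.erase a)) := by
  rw [absorberPaths_eq_cons_erase ha, Multiset.cons_add, Multiset.cons_add, Multiset.add_cons]

variable [DecidableEq V]

/-- The vertices of an absorber other than its centre. -/
def Absorber.arms (a : Absorber V) : Finset V := (a.before ++ a.after).toFinset

/-- The situation preserved by the absorption process, in which `Q` are the paths still to be
rearranged and `𝒜` the absorbers not yet used: at each vertex there are more than enough absorbers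
to remove all coincidences of a start with an end. -/
structure IsAbsorbing (S R : Finset V) (L M : ℕ) (Q : Multiset (List V))
    (𝒜 : Finset (Absorber V)) : Prop where
  two_le_length : ∀ l ∈ Q, 2 ≤ l.length
  nodup : ∀ l ∈ Q, l.Nodup
  potential_le : ∀ l ∈ Q, potential S R L l ≤ M
  isAbsorber : ∀ a ∈ 𝒜, IsAbsorber S R L a
  pairwiseDisjoint : ∀ x, {a | a ∈ 𝒜 ∧ a.centre = x}.PairwiseDisjoint Absorber.arms
  startsAt_pos : ∀ x ∈ S, 0 < startsAt Q x
  endsAt_pos : ∀ x ∈ R, 0 < endsAt Q x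
  min_add_le : ∀ x, min (startsAt (Q + absorberPaths 𝒜) x) (endsAt (Q + absorberPaths 𝒜) x) +
    2 * M ≤ #{a ∈ 𝒜 | a.centre = x}

namespace IsAbsorbing

variable {M : ℕ} {Q : Multiset (List V)} {𝒜 : Finset (Absorber V)}

lemma decomposes (h : IsAbsorbing S R L M Q 𝒜) (hSR : Disjoint S R) :
    Decomposes (Q + absorberPaths 𝒜) (arcsOf (Q + absorberPaths 𝒜)) := by
  rw [arcsOf_add]
  exact .add ⟨h.two_le_length, h.nodup, rfl⟩ (decomposes_absorberPaths hSR h.isAbsorber)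

lemma startsAt_pos_of_ne_zero (h : IsAbsorbing S R L M Q 𝒜) {x : V}
    (hx : startsAt (Q + absorberPaths 𝒜) x ≠ 0) : 0 < startsAt Q x := by
  obtain ⟨l, hl, hlx⟩ := PathDecomp.startsAt_pos.1 (Nat.pos_of_ne_zero hx)
  rcases Multiset.mem_add.1 hl with hlQ | hl𝒜
  · exact PathDecomp.startsAt_pos.2 ⟨l, hlQ, hlx⟩
  · obtain ⟨a, ha, rfl⟩ := Multiset.mem_map.1 hl𝒜
    obtain ⟨s, hs, has⟩ := (h.isAbsorber a ha).startsIn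
    obtain rfl : s = x := by simpa [has] using hlx
    exact h.startsAt_pos s hs

lemma endsAt_pos_of_ne_zero (h : IsAbsorbing S R L M Q 𝒜) {x : V}
    (hx : endsAt (Q + absorberPaths 𝒜) x ≠ 0) : 0 < endsAt Q x := by
  obtain ⟨l, hl, hlx⟩ := PathDecomp.endsAt_pos.1 (Nat.pos_of_ne_zero hx)
  rcases Multiset.mem_add.1 hl with hlQ | hl𝒜
  · exact PathDecomp.endsAt_pos.2 ⟨l, hlQ, hlx⟩
  · obtain ⟨a, ha, rfl⟩ := Multiset.mem_map.1 hl𝒜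
    obtain ⟨r, hr, har⟩ := (h.isAbsorber a ha).endsIn
    obtain rfl : r = x := by simpa [har] using hlx
    exact h.endsAt_pos r hr

lemma exists_absorber_disjoint (h : IsAbsorbing S R L M Q 𝒜) {x : V} {W : Finset V}
    (hW : #W < 2 * M) : ∃ a ∈ 𝒜, a.centre = x ∧ Disjoint a.arms W := by
  by_contra! hmeet
  have hle : #{a ∈ 𝒜 | a.centre = x} ≤ #({a ∈ 𝒜 | a.centre = x}.biUnion fun a => a.arms ∩ W) := by
    refine card_le_card_biUnion (fun a ha b hb hab => ?_) fun a ha => ?_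
    · exact (h.pairwiseDisjoint x (by simpa using ha) (by simpa using hb) hab).mono
        inter_subset_left inter_subset_left
    · rw [mem_filter] at ha
      exact not_disjoint_iff_nonempty_inter.1 (hmeet a ha.1 ha.2)
  have hsub : ({a ∈ 𝒜 | a.centre = x}.biUnion fun a => a.arms ∩ W) ⊆ W :=
    biUnion_subset.2 fun _ _ => inter_subset_right
  have := card_le_card hsub
  have := h.min_add_le x
  omega

lemma exists_exchange (h : IsAbsorbing S R L M Q 𝒜) {x : V}
    (hstart : startsAt (Q + absorberPaths 𝒜) x ≠ 0) (hend : endsAt (Q + absorberPaths 𝒜) x ≠ 0) :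
    ∃ a ∈ 𝒜, ∃ l l' Q', Q = (l ++ [a.centre]) ::ₘ (a.centre :: l') ::ₘ Q' ∧
      Disjoint a.arms (l ++ l').toFinset := by
  obtain ⟨l, hl, hl_last⟩ := PathDecomp.endsAt_pos.1 (h.endsAt_pos_of_ne_zero hend)
  obtain ⟨l', hl', hl'_head⟩ := PathDecomp.startsAt_pos.1 (h.startsAt_pos_of_ne_zero hstart)
  have hne : l' ≠ l := by
    rintro rfl
    exact head?_ne_getLast? (h.two_le_length _ hl) (h.nodup _ hl) (hl'_head.trans hl_last.symm)
  have hlength := (length_le_potential S R L l).trans (h.potential_le l hl)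
  have hlength' := (length_le_potential S R L l').trans (h.potential_le l' hl')
  obtain ⟨l, rfl⟩ := List.getLast?_eq_some_iff.1 hl_last
  obtain ⟨l', rfl⟩ := List.head?_eq_some_iff.1 hl'_head
  obtain ⟨Q, rfl⟩ := Multiset.exists_cons_of_mem hl
  obtain ⟨Q, rfl⟩ := Multiset.exists_cons_of_mem ((Multiset.mem_cons.1 hl').resolve_left hne)
  have hW : #(l ++ l').toFinset < 2 * M := by
    have := List.toFinset_card_le (l ++ l')
    simp only [List.length_append, List.length_cons] at this hlength hlength'
    omega
  obtain ⟨a, ha, rfl, hdisj⟩ := h.exists_absorber_disjoint (x := x) hW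
  exact ⟨a, ha, l, l', Q, rfl, hdisj⟩

lemma min_add_le_exchange [DecidableEq (Absorber V)] {l l' : List V}
    (h : IsAbsorbing S R L M ((l ++ [a.centre]) ::ₘ (a.centre :: l') ::ₘ Q) 𝒜) (ha : a ∈ 𝒜)
    (x : V) :
    min (startsAt ((l ++ a.centre :: a.after) ::ₘ (a.before ++ a.centre :: l') ::ₘ Q +
          absorberPaths (𝒜.erase a)) x)
        (endsAt ((l ++ a.centre :: a.after) ::ₘ (a.before ++ a.centre :: l') ::ₘ Q +
          absorberPaths (𝒜.erase a)) x) + 2 * M ≤ #{b ∈ 𝒜.erase a | b.centre = x} := by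
  have hmin := h.min_add_le x
  rw [cons_cons_add_absorberPaths ha, Absorber.path, startsAt_exchange, endsAt_exchange] at hmin
  rw [Multiset.cons_add, Multiset.cons_add, filter_erase]
  split_ifs at hmin with hax
  · rw [card_erase_of_mem (by simp [ha, hax])]
    omega
  · rwa [erase_eq_of_notMem (s := {b ∈ 𝒜 | b.centre = x}) (by simp [hax])]

lemma exchange [DecidableEq (Absorber V)] {l l' : List V}
    (h : IsAbsorbing S R L M ((l ++ [a.centre]) ::ₘ (a.centre :: l') ::ₘ Q) 𝒜) (ha : a ∈ 𝒜)
    (hdisj : Disjoint a.arms (l ++ l').toFinset) :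
    IsAbsorbing S R L M ((l ++ a.centre :: a.after) ::ₘ (a.before ++ a.centre :: l') ::ₘ Q)
      (𝒜.erase a) := by
  have ha' := h.isAbsorber a ha
  obtain ⟨-, hafter, -⟩ := List.nodup_append.1 ha'.nodup
  have hbefore : (a.before ++ [a.centre]).Nodup :=
    ha'.nodup.sublist (.append_left (by simp) _)
  rw [Absorber.arms, Finset.disjoint_left] at hdisj
  simp only [List.mem_toFinset, List.mem_append] at hdisj
  obtain ⟨hlen, hlen', hlenQ⟩ := by simpa [Multiset.forall_mem_cons] using h.two_le_length
  obtain ⟨hnodup, hnodup', hnodupQ⟩ := by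
    simpa only [Multiset.forall_mem_cons] using h.nodup
  obtain ⟨hpot, hpot', hpotQ⟩ := by simpa only [Multiset.forall_mem_cons] using h.potential_le
  constructor
  · simpa [Multiset.forall_mem_cons] using ⟨by omega, by omega, hlenQ⟩
  · simp only [Multiset.forall_mem_cons]
    exact ⟨nodup_append_cons hnodup hafter fun v hv hv' => hdisj (.inr hv') (.inl hv),
      nodup_append_cons hbefore hnodup' fun v hv hv' => hdisj (.inl hv) (.inr hv'), hnodupQ⟩
  · simpa only [Multiset.forall_mem_cons] using ⟨(ha'.potential_append_le l).trans hpot,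
      (ha'.potential_before_append_le l').trans hpot', hpotQ⟩
  · exact fun b hb => h.isAbsorber b (mem_of_mem_erase hb)
  · exact fun x => (h.pairwiseDisjoint x).subset fun b hb => ⟨mem_of_mem_erase hb.1, hb.2⟩
  · exact fun x hx => ha'.startsAt_exchange_pos hx (h.startsAt_pos x hx)
  · exact fun x hx => ha'.endsAt_exchange_pos hx (h.endsAt_pos x hx)
  · exact h.min_add_le_exchange ha

theorem exists_decomposes (hSR : Disjoint S R) (h : IsAbsorbing S R L M Q 𝒜) :
    ∃ P, Decomposes P (arcsOf (Q + absorberPaths 𝒜)) ∧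
      ∀ v, startsAt P v = 0 ∨ endsAt P v = 0 := by
  classical
  induction 𝒜 using Finset.strongInduction generalizing Q with
  | H 𝒜 ih =>
    by_cases! hend : ∀ v, startsAt (Q + absorberPaths 𝒜) v = 0 ∨ endsAt (Q + absorberPaths 𝒜) v = 0
    · exact ⟨_, h.decomposes hSR, hend⟩
    obtain ⟨x, hstart_ne, hend_ne⟩ := hend
    obtain ⟨a, ha, l, l', Q, rfl, hdisj⟩ := h.exists_exchange hstart_ne hend_ne
    rw [cons_cons_add_absorberPaths ha, Absorber.path, ← arcsOf_exchange, ← Multiset.cons_add,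
      ← Multiset.cons_add]
    exact ih _ (erase_ssubset ha) (h.exchange ha hdisj)

end IsAbsorbing

end Absorption

section Differences

lemma val_lt_val_add_one {n : ℕ} [NeZero n] {x : ZMod n} (hx : x + 1 ≠ 0) :
    x.val < (x + 1).val := by
  have hn : n ≠ 1 := by
    rintro rfl
    exact hx (Subsingleton.elim _ _)
  have hone := ZMod.val_one'' hn
  have hne : x.val + 1 ≠ n := by
    intro h
    refine hx ((ZMod.val_eq_zero _).1 ?_)
    rw [ZMod.val_add, hone, h, Nat.mod_self]
  have hlt := x.val_lt
  rw [ZMod.val_add_of_lt (by omega), hone]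
  exact Nat.lt_succ_self _

section

variable {ι : Type*} (s : Finset ι) (P : ι → Multiset (List V))

lemma arcsOf_sum : arcsOf (∑ i ∈ s, P i) = ∑ i ∈ s, arcsOf (P i) :=
  map_sum (⟨⟨arcsOf, arcsOf_zero⟩, arcsOf_add⟩ : Multiset (List V) →+ Multiset (V × V)) P s

lemma Decomposes.sum {P : ι → Multiset (List V)} {E : ι → Multiset (V × V)}
    (h : ∀ i ∈ s, Decomposes (P i) (E i)) : Decomposes (∑ i ∈ s, P i) (∑ i ∈ s, E i) where
  two_le_length l hl := by
    obtain ⟨i, hi, hl⟩ := Multiset.mem_sum.1 hl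
    exact (h i hi).two_le_length l hl
  nodup l hl := by
    obtain ⟨i, hi, hl⟩ := Multiset.mem_sum.1 hl
    exact (h i hi).nodup l hl
  arcsOf_eq := (arcsOf_sum s P).trans (sum_congr rfl fun i hi => (h i hi).arcsOf_eq)

variable [DecidableEq V]

lemma startsAt_sum (v : V) : startsAt (∑ i ∈ s, P i) v = ∑ i ∈ s, startsAt (P i) v :=
  map_sum (Multiset.countPAddMonoidHom fun l : List V => l.head? = some v) P s

lemma endsAt_sum (v : V) : endsAt (∑ i ∈ s, P i) v = ∑ i ∈ s, endsAt (P i) v :=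
  map_sum (Multiset.countPAddMonoidHom fun l : List V => l.getLast? = some v) P s

end

lemma Decomposes.startsAt_eq_sub [DecidableEq V] {P : Multiset (List V)} {E : Multiset (V × V)}
    (hP : Decomposes P E) {v : V} (hv : startsAt P v = 0 ∨ endsAt P v = 0) :
    startsAt P v = outCount E v - inCount E v := by
  have := hP.outCount_add_endsAt v
  omega

lemma Decomposes.endsAt_eq_sub [DecidableEq V] {P : Multiset (List V)} {E : Multiset (V × V)}
    (hP : Decomposes P E) {v : V} (hv : startsAt P v = 0 ∨ endsAt P v = 0) :
    endsAt P v = inCount E v - outCount E v := by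
  have := hP.outCount_add_endsAt v
  omega

section

variable {p : ℕ}

/-- The arcs of `E` whose ends have colours `i, i` or `i, 2i` under `f`. -/
def exceptionalArcs (E : Finset (V × V)) (f : V → ZMod p) : Finset (V × V) :=
  {e ∈ E | f e.2 = f e.1 ∨ f e.2 = 2 * f e.1}

/-- The arcs of `E` along which `f` increases by `d`, without the exceptional ones. -/
def differenceClass (E : Finset (V × V)) (f : V → ZMod p) (d : ZMod p) : Finset (V × V) :=
  {e ∈ E | ¬ (f e.2 = f e.1 ∨ f e.2 = 2 * f e.1) ∧ f e.2 - f e.1 = d}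

variable {E : Finset (V × V)} {f : V → ZMod p}

lemma mem_differenceClass {e : V × V} {d : ZMod p} :
    e ∈ differenceClass E f d ↔ e ∈ E ∧ f e.2 = f e.1 + d ∧ d ≠ 0 ∧ f e.1 ≠ d := by
  rw [differenceClass, mem_filter, sub_eq_iff_eq_add']
  refine and_congr_right fun _ => ⟨fun ⟨h, hd⟩ => ⟨hd, ?_, ?_⟩, fun ⟨hd, h0, hne⟩ => ⟨?_, hd⟩⟩
  · rintro rfl
    exact h (.inl (hd.trans (add_zero _)))
  · rintro rfl
    exact h (.inr (hd.trans (two_mul _).symm))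
  · rintro (h | h)
    · exact h0 (by linear_combination h - hd)
    · exact hne (by linear_combination hd - h)

lemma exceptionalArcs_add_sum_differenceClass [NeZero p] :
    (exceptionalArcs E f).val + ∑ d, (differenceClass E f d).val = E.val := by
  classical
  ext e
  simp only [exceptionalArcs, differenceClass, filter_val, Multiset.count_add,
    Multiset.count_sum', Multiset.count_filter]
  by_cases h : f e.2 = f e.1 ∨ f e.2 = 2 * f e.1 <;> simp [h]

variable [DecidableEq V] [Fact p.Prime]

lemma exists_decomposes_differenceClass (E : Finset (V × V)) (f : V → ZMod p) (d : ZMod p) :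
    ∃ P, Decomposes P (differenceClass E f d).val ∧ (∀ l ∈ P, l.length ≤ p) ∧
      ∀ v, startsAt P v = 0 ∨ endsAt P v = 0 := by
  -- Along an arc of the class, the value of `f v / d - 2` increases by one without wrapping around.
  have hrank : ∀ e ∈ (differenceClass E f d).val,
      (f e.1 / d - 2).val < (f e.2 / d - 2).val := by
    intro e he
    obtain ⟨-, hdiff, hd, hne⟩ := mem_differenceClass.1 he
    have hsucc : f e.2 / d - 2 = f e.1 / d - 2 + 1 := by
      rw [hdiff, add_div, div_self hd]
      ring
    rw [hsucc]
    refine val_lt_val_add_one fun h => hne ((div_eq_one_iff_eq hd).1 ?_)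
    linear_combination h
  obtain ⟨P, hP, hpairwise, hstart_end⟩ :=
    exists_decomposes_of_rank (ρ := fun v => (f v / d - 2).val) hrank
  refine ⟨P, hP, fun l hl => ?_, hstart_end⟩
  have hnodup : (l.map fun v => f v / d - 2).Nodup :=
    List.pairwise_map.2 ((hpairwise l hl).imp fun h => ne_of_apply_ne ZMod.val h.ne)
  simpa [ZMod.card] using hnodup.length_le_card

end

variable [Fintype V] [DecidableEq V]

section

variable {ι : Type*} [DecidableEq ι]

/-- The number of in-neighbours of `v` of colour `i`. -/
def inColour (E : Finset (V × V)) (f : V → ι) (v : V) (i : ι) : ℕ :=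
  #{u ∈ ({u | (u, v) ∈ E} : Finset V) | f u = i}

/-- The number of out-neighbours of `v` of colour `i`. -/
def outColour (E : Finset (V × V)) (f : V → ι) (v : V) (i : ι) : ℕ :=
  #{w ∈ ({w | (v, w) ∈ E} : Finset V) | f w = i}

lemma inCount_le_inColour {E F : Finset (V × V)} {f : V → ι} {v : V} {i : ι}
    (h : ∀ u, (u, v) ∈ F → (u, v) ∈ E ∧ f u = i) : inCount F.val v ≤ inColour E f v i := by
  rw [inCount_eq_card, inColour, filter_filter]
  exact card_le_card (monotone_filter_right _ fun _ _ => h _)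

lemma outCount_le_outColour {E F : Finset (V × V)} {f : V → ι} {v : V} {i : ι}
    (h : ∀ w, (v, w) ∈ F → (v, w) ∈ E ∧ f w = i) : outCount F.val v ≤ outColour E f v i := by
  rw [outCount_eq_card, outColour, filter_filter]
  exact card_le_card (monotone_filter_right _ fun _ _ => h _)

lemma inColour_le_inCount {E F : Finset (V × V)} {f : V → ι} {v : V} {i : ι}
    (h : ∀ u, (u, v) ∈ E → f u = i → (u, v) ∈ F) : inColour E f v i ≤ inCount F.val v := by
  rw [inCount_eq_card, inColour, filter_filter]
  exact card_le_card (monotone_filter_right _ fun u _ hu => h u hu.1 hu.2)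

lemma outColour_le_outCount {E F : Finset (V × V)} {f : V → ι} {v : V} {i : ι}
    (h : ∀ w, (v, w) ∈ E → f w = i → (v, w) ∈ F) : outColour E f v i ≤ outCount F.val v := by
  rw [outCount_eq_card, outColour, filter_filter]
  exact card_le_card (monotone_filter_right _ fun w _ hw => h w hw.1 hw.2)

/-- A colouring is balanced with respect to the digraph with arc set `E` if each vertex sees each
colour at most `c` times in each direction, and sees all colours about equally often, up to an error
`s`, in the direction in which it has more neighbours. -/
structure IsBalancedColouring (E : Finset (V × V)) (f : V → ι) (s c : ℕ) : Prop where
  inColour_le : ∀ v i, inColour E f v i ≤ c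
  outColour_le : ∀ v i, outColour E f v i ≤ c
  le_add : ∀ v, (∀ i j, inColour E f v i ≤ outColour E f v j + s) ∨
    ∀ i j, outColour E f v i ≤ inColour E f v j + s

end

variable {p : ℕ} [Fact p.Prime] {E : Finset (V × V)} {f : V → ZMod p} {s c : ℕ}

lemma endsAt_le_of_decomposes_differenceClass {P : Multiset (List V)} {d : ZMod p} {v : V}
    (hP : Decomposes P (differenceClass E f d).val) (hv : startsAt P v = 0 ∨ endsAt P v = 0)
    (hle : ∀ i j, inColour E f v i ≤ outColour E f v j + s) (hc : ∀ i, inColour E f v i ≤ c) :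
    endsAt P v ≤ s + if d = f v then c else 0 := by
  have hin : inCount (differenceClass E f d).val v ≤ inColour E f v (f v - d) :=
    inCount_le_inColour fun u hu => by
      obtain ⟨huE, hdiff, -⟩ := mem_differenceClass.1 hu
      exact ⟨huE, eq_sub_of_add_eq hdiff.symm⟩
  rw [hP.endsAt_eq_sub hv]
  split_ifs with hd
  · have := hc (f v - d)
    omega
  rcases eq_or_ne d 0 with h0 | h0
  · have hempty : differenceClass E f d = ∅ :=
      eq_empty_of_forall_notMem fun e he => (mem_differenceClass.1 he).2.2.1 h0
    simp [hempty, inCount]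
  have hout : outColour E f v (f v + d) ≤ outCount (differenceClass E f d).val v :=
    outColour_le_outCount fun w hw hcol => mem_differenceClass.2 ⟨hw, hcol, h0, Ne.symm hd⟩
  have := hle (f v - d) (f v + d)
  omega

lemma startsAt_le_of_decomposes_differenceClass (hp : p ≠ 2) {P : Multiset (List V)} {d : ZMod p}
    {v : V} (hP : Decomposes P (differenceClass E f d).val)
    (hv : startsAt P v = 0 ∨ endsAt P v = 0)
    (hle : ∀ i j, outColour E f v i ≤ inColour E f v j + s) (hc : ∀ i, outColour E f v i ≤ c) :
    startsAt P v ≤ s + if d = f v / 2 then c else 0 := by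
  have htwo : (2 : ZMod p) ≠ 0 := Ring.two_ne_zero (by rwa [ZMod.ringChar_zmod_n])
  have hout : outCount (differenceClass E f d).val v ≤ outColour E f v (f v + d) :=
    outCount_le_outColour fun w hw => by
      obtain ⟨hwE, hdiff, -⟩ := mem_differenceClass.1 hw
      exact ⟨hwE, hdiff⟩
  rw [hP.startsAt_eq_sub hv]
  split_ifs with hd
  · have := hc (f v + d)
    omega
  rcases eq_or_ne d 0 with h0 | h0
  · have hempty : differenceClass E f d = ∅ :=
      eq_empty_of_forall_notMem fun e he => (mem_differenceClass.1 he).2.2.1 h0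
    simp [hempty, outCount]
  have hin : inColour E f v (f v - d) ≤ inCount (differenceClass E f d).val v := by
    refine inColour_le_inCount fun u hu hcol => mem_differenceClass.2 ⟨hu, ?_, h0, fun h => hd ?_⟩
    · rw [hcol, sub_add_cancel]
    · rw [eq_div_iff htwo]
      linear_combination hcol - h
  have := hle (f v + d) (f v - d)
  omega

lemma inCount_exceptionalArcs_le (hp : p ≠ 2) {v : V} (hc : ∀ i, inColour E f v i ≤ c) :
    inCount (exceptionalArcs E f).val v ≤ 2 * c := by
  have htwo : (2 : ZMod p) ≠ 0 := Ring.two_ne_zero (by rwa [ZMod.ringChar_zmod_n])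
  calc inCount (exceptionalArcs E f).val v
      ≤ #({u ∈ ({u | (u, v) ∈ E} : Finset V) | f u = f v} ∪
          {u ∈ ({u | (u, v) ∈ E} : Finset V) | f u = f v / 2}) := by
        rw [inCount_eq_card]
        refine card_le_card fun u => ?_
        simp only [exceptionalArcs, mem_filter, mem_univ, true_and, mem_union, eq_div_iff htwo]
        grind
    _ ≤ inColour E f v (f v) + inColour E f v (f v / 2) := card_union_le _ _
    _ ≤ 2 * c := two_mul c ▸ add_le_add (hc _) (hc _)

lemma outCount_exceptionalArcs_le {v : V} (hc : ∀ i, outColour E f v i ≤ c) :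
    outCount (exceptionalArcs E f).val v ≤ 2 * c := by
  calc outCount (exceptionalArcs E f).val v
      ≤ #({w ∈ ({w | (v, w) ∈ E} : Finset V) | f w = f v} ∪
          {w ∈ ({w | (v, w) ∈ E} : Finset V) | f w = 2 * f v}) := by
        rw [outCount_eq_card, ← filter_or, filter_filter]
        exact card_le_card (monotone_filter_right _ fun w _ hw => by
          simpa [exceptionalArcs] using hw)
    _ ≤ outColour E f v (f v) + outColour E f v (2 * f v) := card_union_le _ _
    _ ≤ 2 * c := two_mul c ▸ add_le_add (hc _) (hc _)

theorem exists_decomposes_of_isBalancedColouring (hp : p ≠ 2) (hE : ∀ e ∈ E, e.1 ≠ e.2)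
    (hf : IsBalancedColouring E f s c) :
    ∃ Q, Decomposes Q E.val ∧ (∀ l ∈ Q, l.length ≤ p) ∧
      ∀ v, min (startsAt Q v) (endsAt Q v) ≤ p * s + 3 * c := by
  have htwo_le : 2 ≤ p := (Fact.out : p.Prime).two_le
  choose P hP hlength hstart_end using exists_decomposes_differenceClass E f
  have hsum (i : ZMod p) : ∑ d : ZMod p, (s + if d = i then c else 0) = p * s + c := by
    simp [sum_add_distrib]
  refine ⟨(exceptionalArcs E f).val.map (fun e => [e.1, e.2]) + ∑ d, P d, ?_, ?_, fun v => ?_⟩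
  · rw [← exceptionalArcs_add_sum_differenceClass (E := E) (f := f)]
    exact (decomposes_map_pair fun e he => hE e (filter_subset _ _ he)).add (.sum _ fun d _ => hP d)
  · intro l hl
    rcases Multiset.mem_add.1 hl with hl | hl
    · obtain ⟨e, -, rfl⟩ := Multiset.mem_map.1 hl
      exact htwo_le
    · obtain ⟨d, -, hd⟩ := Multiset.mem_sum.1 hl
      exact hlength d l hd
  · rw [startsAt_add, endsAt_add, startsAt_map_pair, endsAt_map_pair, startsAt_sum, endsAt_sum]
    rcases hf.le_add v with hle | hle
    · have hends := sum_le_sum fun d (_ : d ∈ univ) => endsAt_le_of_decomposes_differenceClass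
        (hP d) (hstart_end d v) hle (hf.inColour_le v)
      have hexceptional := inCount_exceptionalArcs_le hp (hf.inColour_le v)
      rw [hsum] at hends
      omega
    · have hstarts := sum_le_sum fun d (_ : d ∈ univ) => startsAt_le_of_decomposes_differenceClass
        hp (hP d) (hstart_end d v) hle (hf.outColour_le v)
      have hexceptional := outCount_exceptionalArcs_le (hf.outColour_le v)
      rw [hsum] at hstarts
      omega

end Differences

section Colouring

open MeasureTheory ProbabilityTheory

variable {ι : Type*} [Fintype ι]

lemma measureReal_uniformOn_singleton [MeasurableSpace ι] [MeasurableSingletonClass ι] (i : ι) :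
    (uniformOn Set.univ : Measure ι).real {i} = (Fintype.card ι : ℝ)⁻¹ := by
  rw [measureReal_def, uniformOn_univ, Measure.count_singleton]
  simp

lemma hasSubgaussianMGF_indicator_sub [MeasurableSpace ι] [MeasurableSingletonClass ι] [Nonempty ι]
    (i : ι) :
    HasSubgaussianMGF (fun j => Set.indicator {i} 1 j - (Fintype.card ι : ℝ)⁻¹) (1 / 4)
      (uniformOn Set.univ) := by
  have hmem : ∀ᵐ j ∂(uniformOn Set.univ : Measure ι),
      Set.indicator {i} (1 : ι → ℝ) j ∈ Set.Icc (0 : ℝ) 1 :=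
    .of_forall fun j => ⟨Set.indicator_nonneg (by simp) j, Set.indicator_le_self' (by simp) j⟩
  have h := hasSubgaussianMGF_of_mem_Icc (measurable_of_finite _).aemeasurable hmem
  rw [integral_indicator_one (measurableSet_singleton i), measureReal_uniformOn_singleton] at h
  convert h using 1
  simp
  norm_num

variable [DecidableEq ι]

/-- The difference between the number of vertices of colour `i` in `W` and its mean over all
colourings `f`. -/
noncomputable def colourDeviation (W : Finset V) (f : V → ι) (i : ι) : ℝ :=
  #{w ∈ W | f w = i} - (#W : ℝ) / Fintype.card ι

lemma colourDeviation_eq_sum (W : Finset V) (f : V → ι) (i : ι) :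
    colourDeviation W f i =
      ∑ w ∈ W, (Set.indicator {i} 1 (f w) - (Fintype.card ι : ℝ)⁻¹) := by
  simp [colourDeviation, Set.indicator_apply, div_eq_mul_inv]

variable [Fintype V]

lemma hasSubgaussianMGF_colourDeviation [MeasurableSpace ι] [MeasurableSingletonClass ι]
    [Nonempty ι] (W : Finset V) (i : ι) :
    HasSubgaussianMGF (fun f => colourDeviation W f i) (#W / 4)
      (Measure.pi fun _ : V => (uniformOn Set.univ : Measure ι)) := by
  have hindep := iIndepFun_pi (μ := fun _ : V => (uniformOn Set.univ : Measure ι))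
    (X := fun _ j => Set.indicator {i} 1 j - (Fintype.card ι : ℝ)⁻¹)
    fun _ => (measurable_of_finite _).aemeasurable
  simp only [colourDeviation_eq_sum]
  convert! HasSubgaussianMGF.sum_of_iIndepFun hindep (s := W) (c := fun _ => 1 / 4) fun w _ => ?_
  · simp [div_eq_mul_inv]
  · have heval := measurePreserving_eval (fun _ : V => (uniformOn Set.univ : Measure ι)) w
    exact .of_map heval.aemeasurable (heval.map_eq.symm ▸ hasSubgaussianMGF_indicator_sub i)

lemma measureReal_lt_abs_colourDeviation_le [MeasurableSpace ι] [MeasurableSingletonClass ι]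
    [Nonempty ι] (W : Finset V) (i : ι) {τ : ℝ} (hτ : 0 ≤ τ) :
    (Measure.pi fun _ : V => (uniformOn Set.univ : Measure ι)).real
      {f | τ < |colourDeviation W f i|} ≤ 2 * Real.exp (-(2 * τ ^ 2 / Fintype.card V)) := by
  rcases W.eq_empty_or_nonempty with rfl | hW
  · have : {f : V → ι | τ < |colourDeviation ∅ f i|} = ∅ := by
      simpa [Set.eq_empty_iff_forall_notMem, colourDeviation] using hτ
    rw [this, measureReal_empty]
    positivity
  have hexp : Real.exp (-τ ^ 2 / (2 * ((#W / 4 : NNReal) : ℝ))) ≤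
      Real.exp (-(2 * τ ^ 2 / Fintype.card V)) := by
    have hcard : (#W : ℝ) ≤ Fintype.card V := mod_cast card_le_univ W
    have heq : -τ ^ 2 / (2 * ((#W / 4 : NNReal) : ℝ)) = -(2 * τ ^ 2 / #W) := by
      push_cast
      field_simp
      norm_num
    rw [heq]
    have := hW.card_pos
    gcongr
  have hupper := (hasSubgaussianMGF_colourDeviation W i).measure_ge_le hτ
  have hlower := (hasSubgaussianMGF_colourDeviation W i).neg.measure_ge_le hτ
  rw [two_mul]
  refine le_trans ?_ ((measureReal_union_le _ _).trans
    (add_le_add (hupper.trans hexp) (hlower.trans hexp)))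
  refine measureReal_mono fun f hf => ?_
  exact (lt_abs.1 (Set.mem_ofPred_eq ▸ hf)).imp (fun h => h.le) fun h => h.le

theorem exists_forall_abs_colourDeviation_le [Nonempty ι] {J : Type*} [Fintype J]
    (W : J → Finset V) {τ : ℝ} (hτ : 0 ≤ τ)
    (h : 2 * (Fintype.card J * Fintype.card ι) < Real.exp (2 * τ ^ 2 / Fintype.card V)) :
    ∃ f : V → ι, ∀ j i, |colourDeviation (W j) f i| ≤ τ := by
  let _ : MeasurableSpace ι := ⊤
  by_contra! hcon
  set μ := Measure.pi fun _ : V => (uniformOn Set.univ : Measure ι)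
  have hcover : (⋃ q : J × ι, {f : V → ι | τ < |colourDeviation (W q.1) f q.2|}) = Set.univ :=
    Set.eq_univ_of_forall fun f => by
      obtain ⟨j, i, hji⟩ := hcon f
      exact Set.mem_iUnion.2 ⟨(j, i), hji⟩
  have hsum : (1 : ℝ) ≤
      ∑ _q : J × ι, 2 * Real.exp (-(2 * τ ^ 2 / Fintype.card V)) :=
    calc (1 : ℝ) = μ.real Set.univ := probReal_univ.symm
      _ ≤ ∑ q : J × ι, μ.real {f | τ < |colourDeviation (W q.1) f q.2|} :=
        hcover ▸ measureReal_iUnion_fintype_le _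
      _ ≤ _ := sum_le_sum fun q _ => measureReal_lt_abs_colourDeviation_le (W q.1) q.2 hτ
  rw [sum_const, card_univ, Fintype.card_prod, nsmul_eq_mul, Real.exp_neg, ← mul_assoc,
    ← div_eq_mul_inv, le_div_iff₀ (Real.exp_pos _)] at hsum
  push_cast at hsum
  linarith

variable [DecidableEq V]

lemma isBalancedColouring_of_abs_colourDeviation_le [Nonempty ι] {E : Finset (V × V)} {f : V → ι}
    {τ c : ℕ} (hin : ∀ v i, |colourDeviation {u | (u, v) ∈ E} f i| ≤ τ)
    (hout : ∀ v i, |colourDeviation {w | (v, w) ∈ E} f i| ≤ τ)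
    (hc : Fintype.card V + Fintype.card ι * τ ≤ Fintype.card ι * c) :
    IsBalancedColouring E f (2 * τ) c := by
  have hι : (0 : ℝ) < Fintype.card ι := mod_cast Fintype.card_pos
  have hbound (W : Finset V) : (#W : ℝ) / Fintype.card ι + τ ≤ c := by
    have hW : (#W : ℝ) ≤ Fintype.card V := mod_cast card_le_univ W
    have hc' : (Fintype.card V + Fintype.card ι * τ : ℝ) ≤ Fintype.card ι * c := mod_cast hc
    rw [div_add' _ _ _ hι.ne', div_le_iff₀ hι]
    linarith
  refine ⟨fun v i => ?_, fun v i => ?_, fun v => ?_⟩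
  · have h : (inColour E f v i : ℝ) ≤ c :=
      (sub_le_iff_le_add'.1 (le_of_abs_le (hin v i))).trans (hbound _)
    exact_mod_cast h
  · have h : (outColour E f v i : ℝ) ≤ c :=
      (sub_le_iff_le_add'.1 (le_of_abs_le (hout v i))).trans (hbound _)
    exact_mod_cast h
  have hclose {W W' : Finset V} {i j : ι} (hW : |colourDeviation W f i| ≤ τ)
      (hW' : |colourDeviation W' f j| ≤ τ) (hle : #W ≤ #W') :
      #{w ∈ W | f w = i} ≤ #{w ∈ W' | f w = j} + 2 * τ := by
    have hdiv : (#W : ℝ) / Fintype.card ι ≤ #W' / Fintype.card ι := by gcongr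
    have hupper := (abs_le.1 hW).2
    have hlower := (abs_le.1 hW').1
    rw [colourDeviation] at hupper hlower
    have h : (#{w ∈ W | f w = i} : ℝ) ≤ #{w ∈ W' | f w = j} + 2 * τ := by linarith
    exact_mod_cast h
  exact (le_total #{u | (u, v) ∈ E} #{w | (v, w) ∈ E}).imp
    (fun hle i j => hclose (hin v i) (hout v j) hle)
    fun hle i j => hclose (hout v i) (hin v j) hle

theorem exists_isBalancedColouring [Nonempty ι] (E : Finset (V × V)) {τ c : ℕ}
    (hτ : 4 * (Fintype.card V * Fintype.card ι) < Real.exp (2 * τ ^ 2 / Fintype.card V))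
    (hc : Fintype.card V + Fintype.card ι * τ ≤ Fintype.card ι * c) :
    ∃ f : V → ι, IsBalancedColouring E f (2 * τ) c := by
  let W : V ⊕ V → Finset V :=
    Sum.elim (fun v => ({u | (u, v) ∈ E} : Finset V)) fun v => ({w | (v, w) ∈ E} : Finset V)
  obtain ⟨f, hf⟩ := exists_forall_abs_colourDeviation_le (ι := ι) W τ.cast_nonneg (by
    rw [Fintype.card_sum]
    push_cast
    linarith)
  exact ⟨f, isBalancedColouring_of_abs_colourDeviation_le (fun v => hf (.inl v))
    (fun v => hf (.inr v)) hc⟩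

end Colouring

section Reach

variable [Fintype V]

open scoped Classical in
/-- The vertices from which `x` can be reached by a path of at most `i` steps of `r`. -/
noncomputable def reachSet (r : V → V → Prop) (x : V) : ℕ → Finset V
  | 0 => {x}
  | i + 1 => reachSet r x i ∪ ({w | ∃ u ∈ reachSet r x i, r w u} : Finset V)

variable {r : V → V → Prop} {x : V}

lemma mem_reachSet_succ {i : ℕ} {w : V} :
    w ∈ reachSet r x (i + 1) ↔ w ∈ reachSet r x i ∨ ∃ u ∈ reachSet r x i, r w u := by
  simp [reachSet]

lemma self_mem_reachSet (r : V → V → Prop) (x : V) (i : ℕ) : x ∈ reachSet r x i := by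
  induction i with
  | zero => simp [reachSet]
  | succ i ih => exact mem_reachSet_succ.2 (.inl ih)

lemma exists_path_of_mem_reachSet {i : ℕ} {u : V} (hu : u ∈ reachSet r x i) :
    ∃ l, (l ++ [x]).head? = some u ∧ (l ++ [x]).Nodup ∧ (l ++ [x]).IsChain r ∧ l.length ≤ i ∧
      ∀ v ∈ l ++ [x], v ∈ reachSet r x i := by
  induction i generalizing u with
  | zero => exact ⟨[], by simp_all [reachSet]⟩
  | succ i ih =>
    have hmono {v : V} (hv : v ∈ reachSet r x i) : v ∈ reachSet r x (i + 1) :=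
      mem_reachSet_succ.2 (.inl hv)
    by_cases hui : u ∈ reachSet r x i
    · obtain ⟨l, hhead, hnodup, hchain, hlength, hmem⟩ := ih hui
      exact ⟨l, hhead, hnodup, hchain, hlength.trans i.le_succ, fun v hv => hmono (hmem v hv)⟩
    obtain ⟨w, hw, huw⟩ := (mem_reachSet_succ.1 hu).resolve_left hui
    obtain ⟨l, hhead, hnodup, hchain, hlength, hmem⟩ := ih hw
    refine ⟨u :: l, rfl, hnodup.cons fun hul => hui (hmem u hul), ?_, by simpa using hlength, ?_⟩
    · exact List.isChain_cons.2 ⟨by simp [hhead, huw], hchain⟩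
    · exact List.forall_mem_cons.2 ⟨hu, fun v hv => hmono (hmem v hv)⟩

open scoped Classical in
lemma card_compl_reachSet_mul_le {Y : Finset V} {c : ℕ}
    (h : ∀ X : Finset V, X.Nonempty → Disjoint X Y → #Xᶜ ≤ 2 * #{w ∈ Xᶜ | ∃ u ∈ X, r w u} + c)
    {i : ℕ} (hd : Disjoint (reachSet r x i) Y) :
    #(reachSet r x i)ᶜ * 2 ^ i ≤ Fintype.card V + c * 2 ^ i := by
  induction i with
  | zero => simpa using (card_le_univ _).trans (Nat.le_add_right _ c)
  | succ i ih =>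
    set X := reachSet r x i with hX
    set N : Finset V := {w ∈ Xᶜ | ∃ u ∈ X, r w u} with hN
    have hdX : Disjoint X Y := hd.mono_left fun v hv => mem_reachSet_succ.2 (.inl hv)
    have hcompl : (reachSet r x (i + 1))ᶜ = Xᶜ \ N := by
      ext w
      simp only [hN, hX, mem_compl, mem_reachSet_succ, mem_sdiff, mem_filter, not_or, not_and,
        and_congr_right_iff]
      exact fun hw => ⟨fun h _ => h, fun h => h hw⟩
    have hcard : #(Xᶜ \ N) + #N = #Xᶜ := card_sdiff_add_card_eq_card (filter_subset _ _)
    have hhalf : 2 * #(Xᶜ \ N) ≤ #Xᶜ + c := by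
      have : #Xᶜ ≤ 2 * #N + c := h X ⟨x, self_mem_reachSet r x i⟩ hdX
      omega
    have := Nat.mul_le_mul_right (2 ^ i) hhalf
    have := ih hdX
    rw [hcompl, pow_succ]
    linarith

open scoped Classical in
lemma exists_path_of_expansion (x : V) {Y : Finset V} {c L : ℕ}
    (h : ∀ X : Finset V, X.Nonempty → Disjoint X Y → #Xᶜ ≤ 2 * #{w ∈ Xᶜ | ∃ u ∈ X, r w u} + c)
    (hL : Fintype.card V ≤ 2 ^ L) (hY : c + 1 < #Y) :
    ∃ l, StartsIn Y (l ++ [x]) ∧ (l ++ [x]).Nodup ∧ (l ++ [x]).IsChain r ∧ l.length ≤ L := by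
  have hmeet : ¬ Disjoint (reachSet r x L) Y := fun hd => by
    have hYle : #Y ≤ #(reachSet r x L)ᶜ := card_le_card fun y hy =>
      mem_compl.2 fun hyX => disjoint_left.1 hd hyX hy
    have hmul := Nat.mul_le_mul_right (2 ^ L) (hY.trans_le hYle)
    have hpos : 0 < 2 ^ L := by positivity
    have := card_compl_reachSet_mul_le h hd
    linarith
  obtain ⟨u, hu, huY⟩ := not_disjoint_iff.1 hmeet
  obtain ⟨l, hhead, hnodup, hchain, hlength, -⟩ := exists_path_of_mem_reachSet hu
  exact ⟨l, ⟨u, huY, hhead⟩, hnodup, hchain, hlength⟩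

variable {A : V → V → Prop} [DecidableRel A] {t d : ℕ}

lemma sum_card_out_compl_le [DecidableEq V] {X : Finset V}
    (ht : ∀ u ∈ X, #{w | A u w} ≤ #{w | A w u} + t) :
    ∑ u ∈ X, #{w ∈ Xᶜ | A u w} ≤ ∑ u ∈ X, #{w ∈ Xᶜ | A w u} + #X * t := by
  have hsplit (B : V → Prop) [DecidablePred B] :
      #{w | B w} = #{w ∈ X | B w} + #{w ∈ Xᶜ | B w} := by
    rw [← card_union_of_disjoint (disjoint_filter_filter disjoint_compl_right), ← filter_union,
      union_compl]
  have hinner : ∑ u ∈ X, #{w ∈ X | A u w} = ∑ u ∈ X, #{w ∈ X | A w u} :=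
    sum_card_bipartiteAbove_eq_sum_card_bipartiteBelow A
  have hsum := sum_le_sum ht
  simp only [hsplit, sum_add_distrib, sum_const, smul_eq_mul] at hsum
  omega

open scoped Classical in
/-- Counting the arcs of `A` between `X` and its complement: at least about half of them enter `X`,
and all but `d` at each vertex of `X` start at vertices counted on the right. -/
lemma card_compl_le_two_mul_card_add (hA : ∀ u v, u ≠ v → A u v ∨ A v u)
    (hr : ∀ u, ∃ W : Finset V, #W ≤ d ∧ ∀ w ∉ W, A w u → r w u) {X : Finset V} (hX : X.Nonempty)
    (ht : ∀ u ∈ X, #{w | A u w} ≤ #{w | A w u} + t) :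
    #Xᶜ ≤ 2 * #{w ∈ Xᶜ | ∃ u ∈ X, r w u} + (t + 2 * d) := by
  set N : Finset V := {w ∈ Xᶜ | ∃ u ∈ X, r w u}
  have htotal : ∀ u ∈ X, #Xᶜ ≤ #{w ∈ Xᶜ | A u w} + #{w ∈ Xᶜ | A w u} := fun u hu => by
    refine le_trans (card_le_card fun w hw => ?_) (card_union_le _ _)
    have hne : u ≠ w := fun h => mem_compl.1 hw (h ▸ hu)
    simpa [hw, -mem_compl] using hA u w hne
  have hin : ∀ u ∈ X, #{w ∈ Xᶜ | A w u} ≤ #N + d := fun u hu => by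
    obtain ⟨W, hW, hrW⟩ := hr u
    refine (card_le_card (t := N ∪ W) fun w hw => ?_).trans
      ((card_union_le _ _).trans (Nat.add_le_add_left hW _))
    rw [mem_filter] at hw
    by_cases hwW : w ∈ W
    · exact mem_union_right _ hwW
    · exact mem_union_left _ (mem_filter.2 ⟨hw.1, u, hu, hrW w hwW hw.2⟩)
  have hcross := sum_le_sum htotal
  have hentering := sum_le_sum hin
  have hleaving := sum_card_out_compl_le ht
  simp only [sum_const, smul_eq_mul, sum_add_distrib] at hcross hentering
  refine Nat.le_of_mul_le_mul_left ?_ hX.card_pos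
  linarith

lemma exists_connecting_path (hA : ∀ u v, u ≠ v → A u v ∨ A v u)
    (hr : ∀ u, ∃ W : Finset V, #W ≤ d ∧ ∀ w ∉ W, A w u → r w u) (x : V) {Y : Finset V} {L : ℕ}
    (ht : ∀ u ∉ Y, #{w | A u w} ≤ #{w | A w u} + t) (hL : Fintype.card V ≤ 2 ^ L)
    (hY : t + 2 * d + 1 < #Y) :
    ∃ l, StartsIn Y (l ++ [x]) ∧ (l ++ [x]).Nodup ∧ (l ++ [x]).IsChain r ∧ l.length ≤ L ∧
      (x ∈ Y → l = []) := by
  by_cases hx : x ∈ Y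
  · exact ⟨[], ⟨x, hx, rfl⟩, by simp⟩
  obtain ⟨l, hstarts, hnodup, hchain, hlength⟩ := exists_path_of_expansion x
    (fun X hX hd => card_compl_le_two_mul_card_add hA hr hX fun u hu =>
      ht u (disjoint_left.1 hd hu)) hL hY
  exact ⟨l, hstarts, hnodup, hchain, hlength, fun h => absurd h hx⟩

end Reach

section AbsorberSystem

lemma forall_mem_of_isChain_cons {p : V → Prop} {r : V → V → Prop} {l : List V} {x : V}
    (h : (x :: l).IsChain r) (hr : ∀ v w, r v w → p w) : ∀ v ∈ l, p v := by
  induction l generalizing x with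
  | nil => simp
  | cons a l ih =>
    obtain ⟨hhead, htail⟩ := List.isChain_cons_cons.1 h
    exact List.forall_mem_cons.2 ⟨hr x a hhead, ih htail⟩

lemma forall_mem_of_isChain_append_singleton {p : V → Prop} {r : V → V → Prop} {l : List V} {x : V}
    (h : (l ++ [x]).IsChain r) (hr : ∀ v w, r v w → p v) : ∀ v ∈ l, p v := by
  have hreverse : (x :: l.reverse).IsChain fun w v => r v w := by
    simpa using List.isChain_reverse.2 h
  simpa using forall_mem_of_isChain_cons hreverse fun v w => hr w v

lemma arcsOf_absorberPaths_cons_le [Fintype V] {T : Digraph V} {𝒜 : Finset (Absorber V)}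
    {a : Absorber V} (h : arcsOf (absorberPaths 𝒜) ≤ (arcFinset T).val) (ha : a.path.Nodup)
    (harcs : ∀ e ∈ arcs a.path, T.Adj e.1 e.2 ∧ e ∉ arcsOf (absorberPaths 𝒜)) (hnot : a ∉ 𝒜) :
    arcsOf (absorberPaths (cons a 𝒜 hnot)) ≤ (arcFinset T).val := by
  rw [absorberPaths, cons_val, Multiset.map_cons, arcsOf_cons, ← absorberPaths]
  refine (Multiset.le_iff_subset ?_).2 fun e he => ?_
  · refine Multiset.nodup_add.2 ⟨by simpa using nodup_arcs ha,
      Multiset.nodup_of_le h (arcFinset T).nodup, Multiset.disjoint_left.2 fun {e} he => ?_⟩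
    exact (harcs e (by simpa using he)).2
  · rcases Multiset.mem_add.1 he with he | he
    · exact mem_arcFinset.2 (harcs e (by simpa using he)).1
    · exact Multiset.mem_of_le h he

variable [DecidableEq V]

lemma Absorber.mem_path_iff {a : Absorber V} {v : V} :
    v ∈ a.path ↔ v ∈ a.arms ∨ a.centre = v := by
  simp only [path, arms, List.mem_append, List.mem_cons, List.mem_toFinset, eq_comm (a := v)]
  tauto

namespace IsAbsorber

variable {S R : Finset V} {L : ℕ} {a : Absorber V}

lemma card_arms_le (ha : IsAbsorber S R L a) : #a.arms ≤ 2 * L := by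
  refine (List.toFinset_card_le _).trans ?_
  rw [List.length_append, two_mul]
  exact Nat.add_le_add ha.length_before_le ha.length_after_le

lemma arms_nonempty (ha : IsAbsorber S R L a) (hSR : Disjoint S R) : a.arms.Nonempty := by
  have hlength := ha.two_le_length hSR
  rw [Absorber.path, List.length_append, List.length_cons] at hlength
  rw [Absorber.arms, List.toFinset_nonempty_iff, ← List.length_pos_iff, List.length_append]
  omega

end IsAbsorber

variable [Fintype V]

/-- The vertices whose out-degree exceeds their in-degree by at least `t`. -/
noncomputable def surplus (D : Digraph V) (t : ℕ) : Finset V :=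
  {v | inCount (arcFinset D).val v + t ≤ outCount (arcFinset D).val v}

/-- The vertices whose in-degree exceeds their out-degree by at least `t`. -/
noncomputable def deficit (D : Digraph V) (t : ℕ) : Finset V :=
  {v | outCount (arcFinset D).val v + t ≤ inCount (arcFinset D).val v}

lemma mem_surplus {D : Digraph V} {t : ℕ} {v : V} :
    v ∈ surplus D t ↔ inCount (arcFinset D).val v + t ≤ outCount (arcFinset D).val v := by
  simp [surplus]

lemma mem_deficit {D : Digraph V} {t : ℕ} {v : V} :
    v ∈ deficit D t ↔ outCount (arcFinset D).val v + t ≤ inCount (arcFinset D).val v := by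
  simp [deficit]

lemma disjoint_surplus_deficit (D : Digraph V) {t : ℕ} (ht : 0 < t) :
    Disjoint (surplus D t) (deficit D t) :=
  disjoint_left.2 fun v hS hR => by
    rw [mem_surplus] at hS
    rw [mem_deficit] at hR
    omega

lemma card_mem_le_inCount (M : Multiset (V × V)) (v : V) : #{u | (u, v) ∈ M} ≤ inCount M v := by
  have h := inCount_eq_card M.toFinset v
  simp only [Multiset.mem_toFinset] at h
  exact h ▸ Multiset.countP_le_of_le _ (Multiset.dedup_le M)

lemma card_mem_le_outCount (M : Multiset (V × V)) (v : V) : #{w | (v, w) ∈ M} ≤ outCount M v := by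
  have h := outCount_eq_card M.toFinset v
  simp only [Multiset.mem_toFinset] at h
  exact h ▸ Multiset.countP_le_of_le _ (Multiset.dedup_le M)

variable {T : Digraph V} {L t d : ℕ} {M : Multiset (V × V)}

lemma exists_path_from_surplus (hT : IsTournament T) (hM : ∀ v, inCount M v ≤ d)
    (hL : Fintype.card V ≤ 2 ^ L) {Z : Finset V} (hS : t + 2 * (d + #Z) + 1 < #(surplus T t))
    (x : V) :
    ∃ l, StartsIn (surplus T t) (l ++ [x]) ∧ (l ++ [x]).Nodup ∧
      (l ++ [x]).IsChain (fun v w => T.Adj v w ∧ (v, w) ∉ M ∧ v ∉ Z) ∧ l.length ≤ L ∧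
      (x ∈ surplus T t → l = []) := by
  have hr (u : V) : ∃ W : Finset V, #W ≤ d + #Z ∧ ∀ w ∉ W, (w, u) ∈ arcFinset T →
      T.Adj w u ∧ (w, u) ∉ M ∧ w ∉ Z := by
    refine ⟨({w | (w, u) ∈ M} : Finset V) ∪ Z, (card_union_le _ _).trans ?_, fun w hw hwu => ?_⟩
    · exact Nat.add_le_add_right ((card_mem_le_inCount M u).trans (hM u)) _
    · simp_all
  have ht (u : V) (hu : u ∉ surplus T t) :
      #{w | (u, w) ∈ arcFinset T} ≤ #{w | (w, u) ∈ arcFinset T} + t := by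
    rw [← outCount_eq_card, ← inCount_eq_card]
    rw [mem_surplus] at hu
    omega
  exact exists_connecting_path (A := fun v w => (v, w) ∈ arcFinset T)
    (fun u v huv => by simpa using (hT.2 u v huv).or) hr x ht hL hS

lemma exists_path_to_deficit (hT : IsTournament T) (hM : ∀ v, outCount M v ≤ d)
    (hL : Fintype.card V ≤ 2 ^ L) {Z : Finset V} (hR : t + 2 * (d + #Z) + 1 < #(deficit T t))
    (x : V) :
    ∃ l, EndsIn (deficit T t) (x :: l) ∧ (x :: l).Nodup ∧
      (x :: l).IsChain (fun v w => T.Adj v w ∧ (v, w) ∉ M ∧ w ∉ Z) ∧ l.length ≤ L ∧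
      (x ∈ deficit T t → l = []) := by
  have hr (u : V) : ∃ W : Finset V, #W ≤ d + #Z ∧ ∀ w ∉ W, (u, w) ∈ arcFinset T →
      T.Adj u w ∧ (u, w) ∉ M ∧ w ∉ Z := by
    refine ⟨({w | (u, w) ∈ M} : Finset V) ∪ Z, (card_union_le _ _).trans ?_, fun w hw hwu => ?_⟩
    · exact Nat.add_le_add_right ((card_mem_le_outCount M u).trans (hM u)) _
    · simp_all
  have ht (u : V) (hu : u ∉ deficit T t) :
      #{w | (w, u) ∈ arcFinset T} ≤ #{w | (u, w) ∈ arcFinset T} + t := by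
    rw [← outCount_eq_card, ← inCount_eq_card]
    rw [mem_deficit] at hu
    omega
  obtain ⟨l, hstarts, hnodup, hchain, hlength, hnil⟩ := exists_connecting_path
    (A := fun w v => (v, w) ∈ arcFinset T) (fun u v huv => by simpa using (hT.2 u v huv).or.symm)
    hr x ht hL hR
  have hreverse : x :: l.reverse = (l ++ [x]).reverse := by simp
  refine ⟨l.reverse, ?_, ?_, ?_, by simpa using hlength, by simpa using hnil⟩
  · simpa only [EndsIn, StartsIn, hreverse, List.getLast?_reverse] using hstarts
  · rwa [hreverse, List.nodup_reverse]
  · rwa [hreverse, List.isChain_reverse]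

lemma exists_isAbsorber (hT : IsTournament T) (hMin : ∀ v, inCount M v ≤ d)
    (hMout : ∀ v, outCount M v ≤ d) (hL : Fintype.card V ≤ 2 ^ L) {Z : Finset V}
    (hS : t + 2 * (d + (#Z + L)) + 1 < #(surplus T t))
    (hR : t + 2 * (d + (#Z + L)) + 1 < #(deficit T t)) (x : V) :
    ∃ a : Absorber V, a.centre = x ∧ IsAbsorber (surplus T t) (deficit T t) L a ∧
      (∀ e ∈ arcs a.path, T.Adj e.1 e.2 ∧ e ∉ M) ∧ Disjoint a.arms Z := by
  obtain ⟨l, hstarts, hnodup, hchain, hlength, hnil⟩ :=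
    exists_path_from_surplus (t := t) (Z := Z) hT hMin hL (by omega) x
  have hZ : #(Z ∪ l.toFinset) ≤ #Z + L :=
    (card_union_le _ _).trans (Nat.add_le_add_left (l.toFinset_card_le.trans hlength) _)
  obtain ⟨l', hends, hnodup', hchain', hlength', hnil'⟩ :=
    exists_path_to_deficit (t := t) (Z := Z ∪ l.toFinset) hT hMout hL (by omega) x
  have hlZ : ∀ v ∈ l, v ∉ Z := forall_mem_of_isChain_append_singleton hchain fun _ _ h => h.2.2
  have hl'Z : ∀ v ∈ l', v ∉ Z ∪ l.toFinset :=
    forall_mem_of_isChain_cons hchain' fun _ _ h => h.2.2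
  refine ⟨⟨l, x, l'⟩, rfl, ⟨nodup_append_cons hnodup hnodup' ?_, ?_, ?_, hlength, hlength', hnil,
    hnil'⟩, ?_, ?_⟩
  · exact fun v hv hv' => hl'Z v hv' (mem_union_right _ (List.mem_toFinset.2 hv))
  · simpa only [StartsIn, Absorber.path, head?_append_cons l] using hstarts
  · simpa only [EndsIn, Absorber.path, List.getLast?_append_cons] using hends
  · intro e he
    rw [Absorber.path, arcs_append_cons, List.mem_append] at he
    rcases he with he | he
    · exact (isChain_iff_forall_mem_arcs.1 hchain e he).imp_right And.left
    · exact (isChain_iff_forall_mem_arcs.1 hchain' e he).imp_right And.left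
  · simp only [Absorber.arms, disjoint_left, List.mem_toFinset, List.mem_append]
    exact fun v hv => hv.elim (hlZ v) fun hv' hvZ => hl'Z v hv' (mem_union_left _ hvZ)

/-- A system of arc-disjoint absorbers of the digraph `T`, with at most `k` absorbers for each
centre, those with the same centre meeting only there, and with each vertex on at most `Δ` absorbers
with other centres. -/
structure IsAbsorberSystem (T : Digraph V) (S R : Finset V) (L k Δ : ℕ)
    (𝒜 : Finset (Absorber V)) : Prop where
  isAbsorber : ∀ a ∈ 𝒜, IsAbsorber S R L a
  pairwiseDisjoint : ∀ x, {a | a ∈ 𝒜 ∧ a.centre = x}.PairwiseDisjoint Absorber.arms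
  arcsOf_le : arcsOf (absorberPaths 𝒜) ≤ (arcFinset T).val
  card_centre_le : ∀ x, #{a ∈ 𝒜 | a.centre = x} ≤ k
  card_arms_le : ∀ v, #{a ∈ 𝒜 | v ∈ a.arms} ≤ Δ

namespace IsAbsorberSystem

variable {S R : Finset V} {k Δ : ℕ} {𝒜 : Finset (Absorber V)}

lemma countP_mem_le (h : IsAbsorberSystem T S R L k Δ 𝒜) (v : V) :
    (absorberPaths 𝒜).countP (v ∈ ·) ≤ Δ + k := by
  classical
  rw [absorberPaths, Multiset.countP_map, ← filter_val, card_val]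
  simp only [Absorber.mem_path_iff, filter_or]
  exact (card_union_le _ _).trans (Nat.add_le_add (h.card_arms_le v) (h.card_centre_le v))

lemma card_le_mul (h : IsAbsorberSystem T S R L k Δ 𝒜) : #𝒜 ≤ Fintype.card V * k := by
  rw [card_eq_sum_card_fiberwise (f := Absorber.centre) (t := univ) (fun _ _ => by simp)]
  exact (sum_le_card_nsmul _ _ k fun x _ => h.card_centre_le x).trans_eq (by simp)

lemma card_overloaded_le (h : IsAbsorberSystem T S R L k Δ 𝒜) (hΔ : 0 < Δ)
    (hLk : 2 * L * k * Fintype.card V ≤ Δ ^ 2) : #{v | Δ ≤ #{a ∈ 𝒜 | v ∈ a.arms}} ≤ Δ := by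
  have hload : ∑ v, #{a ∈ 𝒜 | v ∈ a.arms} ≤ #𝒜 * (2 * L) := calc
    ∑ v, #{a ∈ 𝒜 | v ∈ a.arms} = ∑ a ∈ 𝒜, #a.arms := by
      simpa [bipartiteAbove, bipartiteBelow] using
        sum_card_bipartiteAbove_eq_sum_card_bipartiteBelow (s := (univ : Finset V)) (t := 𝒜)
          fun v a => v ∈ a.arms
    _ ≤ #𝒜 * (2 * L) := sum_le_card_nsmul _ _ _ fun a ha => (h.isAbsorber a ha).card_arms_le
  have hmarkov : #{v | Δ ≤ #{a ∈ 𝒜 | v ∈ a.arms}} * Δ ≤ ∑ v, #{a ∈ 𝒜 | v ∈ a.arms} :=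
    (card_nsmul_le_sum _ _ Δ fun v hv => (mem_filter.1 hv).2).trans
      (sum_le_sum_of_subset (subset_univ _))
  have htotal := Nat.mul_le_mul_right (2 * L) h.card_le_mul
  refine Nat.le_of_mul_le_mul_right ?_ hΔ
  linarith

lemma exists_forbidden (h : IsAbsorberSystem T S R L k Δ 𝒜) (hΔ : 0 < Δ)
    (hLk : 2 * L * k * Fintype.card V ≤ Δ ^ 2) (x : V) :
    ∃ Z : Finset V, #Z ≤ Δ + k * (2 * L) ∧ (∀ v, Δ ≤ #{a ∈ 𝒜 | v ∈ a.arms} → v ∈ Z) ∧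
      ∀ a ∈ 𝒜, a.centre = x → a.arms ⊆ Z := by
  refine ⟨({v | Δ ≤ #{a ∈ 𝒜 | v ∈ a.arms}} : Finset V) ∪
    {a ∈ 𝒜 | a.centre = x}.biUnion Absorber.arms, ?_, ?_, ?_⟩
  · refine (card_union_le _ _).trans (Nat.add_le_add (h.card_overloaded_le hΔ hLk) ?_)
    exact (card_biUnion_le_card_mul _ _ _ fun a ha =>
      (h.isAbsorber a (mem_filter.1 ha).1).card_arms_le).trans
        (Nat.mul_le_mul_right _ (h.card_centre_le x))
  · exact fun v hv => mem_union_left _ (by simpa using hv)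
  · exact fun a ha hax => (subset_biUnion_of_mem Absorber.arms (mem_filter.2 ⟨ha, hax⟩)).trans
      subset_union_right

variable {a : Absorber V}

lemma cons (h : IsAbsorberSystem T S R L k Δ 𝒜) (ha : IsAbsorber S R L a)
    (hk : #{b ∈ 𝒜 | b.centre = a.centre} < k) (hload : ∀ v ∈ a.arms, #{b ∈ 𝒜 | v ∈ b.arms} < Δ)
    (hdisj : ∀ b ∈ 𝒜, b.centre = a.centre → Disjoint a.arms b.arms)
    (harcs : ∀ e ∈ arcs a.path, T.Adj e.1 e.2 ∧ e ∉ arcsOf (absorberPaths 𝒜)) (hnot : a ∉ 𝒜) :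
    IsAbsorberSystem T S R L k Δ (cons a 𝒜 hnot) where
  isAbsorber := forall_mem_cons .. |>.2 ⟨ha, h.isAbsorber⟩
  pairwiseDisjoint x b hb c hc hne := by
    simp only [mem_cons, Set.mem_ofPred_eq] at hb hc
    obtain ⟨rfl | hb, rfl⟩ := hb <;> obtain ⟨rfl | hc, hcb⟩ := hc
    · exact absurd rfl hne
    · exact hdisj c hc hcb
    · exact (hdisj b hb hcb.symm).symm
    · exact h.pairwiseDisjoint _ ⟨hb, rfl⟩ ⟨hc, hcb⟩ hne
  arcsOf_le := arcsOf_absorberPaths_cons_le h.arcsOf_le ha.nodup harcs hnot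
  card_centre_le x := by
    rw [filter_cons]
    split_ifs with hx
    · subst hx
      simpa using hk
    · exact h.card_centre_le x
  card_arms_le v := by
    rw [filter_cons]
    split_ifs with hv
    · simpa using hload v hv
    · exact h.card_arms_le v

end IsAbsorberSystem

variable {k Δ : ℕ}

lemma IsAbsorberSystem.exists_cons {𝒜 : Finset (Absorber V)}
    (h : IsAbsorberSystem T (surplus T t) (deficit T t) L k Δ 𝒜) (hT : IsTournament T)
    (ht : 0 < t) (hΔ : 0 < Δ) (hLk : 2 * L * k * Fintype.card V ≤ Δ ^ 2)
    (hL : Fintype.card V ≤ 2 ^ L)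
    (hS : t + 2 * ((Δ + k) + (Δ + k * (2 * L) + L)) + 1 < #(surplus T t))
    (hR : t + 2 * ((Δ + k) + (Δ + k * (2 * L) + L)) + 1 < #(deficit T t)) {x : V}
    (hx : #{a ∈ 𝒜 | a.centre = x} < k) :
    ∃ (a : Absorber V) (ha : a ∉ 𝒜),
      IsAbsorberSystem T (surplus T t) (deficit T t) L k Δ (Finset.cons a 𝒜 ha) := by
  have hSR := disjoint_surplus_deficit T ht
  have hdec := decomposes_absorberPaths hSR h.isAbsorber
  obtain ⟨Z, hZ, hoverloaded, harms⟩ := h.exists_forbidden hΔ hLk x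
  obtain ⟨a, rfl, ha, harcs, hdisj⟩ := exists_isAbsorber (t := t) (Z := Z) hT
    (fun v => (hdec.inCount_le v).trans (h.countP_mem_le v))
    (fun v => (hdec.outCount_le v).trans (h.countP_mem_le v)) hL (by omega) (by omega) x
  have hnot : a ∉ 𝒜 := fun hmem =>
    (ha.arms_nonempty hSR).ne_empty (disjoint_self.1 (hdisj.mono_right (harms a hmem rfl)))
  refine ⟨a, hnot, h.cons ha hx (fun v hv => ?_) (fun b hb hba => ?_) harcs hnot⟩
  · exact lt_of_not_ge fun hle => disjoint_left.1 hdisj hv (hoverloaded v hle)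
  · exact hdisj.mono_right (harms b hb hba)

theorem exists_isAbsorberSystem (hT : IsTournament T) (ht : 0 < t) (hΔ : 0 < Δ)
    (hLk : 2 * L * k * Fintype.card V ≤ Δ ^ 2) (hL : Fintype.card V ≤ 2 ^ L)
    (hS : t + 2 * ((Δ + k) + (Δ + k * (2 * L) + L)) + 1 < #(surplus T t))
    (hR : t + 2 * ((Δ + k) + (Δ + k * (2 * L) + L)) + 1 < #(deficit T t)) :
    ∃ 𝒜, IsAbsorberSystem T (surplus T t) (deficit T t) L k Δ 𝒜 ∧
      ∀ x, #{a ∈ 𝒜 | a.centre = x} = k := by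
  by_contra! hcon
  have hsystem (m : ℕ) :
      ∃ 𝒜, IsAbsorberSystem T (surplus T t) (deficit T t) L k Δ 𝒜 ∧ #𝒜 = m := by
    induction m with
    | zero => exact ⟨∅, ⟨by simp, by simp, by simp [absorberPaths], by simp, by simp⟩, rfl⟩
    | succ m ih =>
      obtain ⟨𝒜, h𝒜, rfl⟩ := ih
      obtain ⟨x, hx⟩ := hcon 𝒜 h𝒜
      obtain ⟨a, ha, hcons⟩ := h𝒜.exists_cons hT ht hΔ hLk hL hS hR
        ((h𝒜.card_centre_le x).lt_of_ne hx)
      exact ⟨_, hcons, card_cons ha⟩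
  obtain ⟨𝒜, h𝒜, hcard⟩ := hsystem (Fintype.card V * k + 1)
  have hle := h𝒜.card_le_mul
  omega

end AbsorberSystem

section Excess

variable [Fintype V] (D : Digraph V)

lemma sum_toNat_le {g : V → ℤ} {N : ℕ} (hg : ∀ v, g v ≤ N) (t : ℕ) :
    ∑ v, (g v).toNat ≤ N * #{v | t ≤ g v} + Fintype.card V * t := by
  have h : ∀ v, (g v).toNat ≤ (if t ≤ g v then N else 0) + t := fun v => by
    have := hg v
    split_ifs <;> omega
  refine (sum_le_sum fun v _ => h v).trans_eq ?_
  rw [sum_add_distrib, ← sum_filter, sum_const, sum_const, card_univ, smul_eq_mul, smul_eq_mul,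
    mul_comm N]

lemma excessAt_eq_outCount_sub_inCount [DecidableEq V] (v : V) :
    excessAt D v = outCount (arcFinset D).val v - inCount (arcFinset D).val v := by
  rw [excessAt, outdeg_eq_outCount, indeg_eq_inCount]

lemma abs_excessAt_le (v : V) : |excessAt D v| ≤ Fintype.card V := by
  classical
  rw [excessAt_eq_outCount_sub_inCount, outCount_eq_card, inCount_eq_card]
  have hout := card_le_univ {w | (v, w) ∈ arcFinset D}
  have hin := card_le_univ {w | (w, v) ∈ arcFinset D}
  rw [abs_le]
  omega

lemma sum_excessAt : ∑ v, excessAt D v = 0 := by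
  classical
  simp only [excessAt_eq_outCount_sub_inCount, sum_sub_distrib, sub_eq_zero, outCount_eq_card,
    inCount_eq_card]
  exact_mod_cast
    sum_card_bipartiteAbove_eq_sum_card_bipartiteBelow fun v w => (v, w) ∈ arcFinset D

lemma excess_eq_sum_neg : excess D = ∑ v, (-excessAt D v).toNat := by
  have hsub : ∑ v, (((excessAt D v).toNat : ℤ) - (-excessAt D v).toNat) = 0 := by
    simp only [Int.toNat_sub_toNat_neg, sum_excessAt]
  rw [sum_sub_distrib, sub_eq_zero] at hsub
  exact_mod_cast hsub

lemma excess_le_mul_card_surplus_add [DecidableEq V] (t : ℕ) :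
    excess D ≤ Fintype.card V * (#(surplus D t) + t) := by
  have h := sum_toNat_le (fun v => (le_abs_self _).trans (abs_excessAt_le D v)) t
  have hsurplus : ({v | t ≤ excessAt D v} : Finset V) = surplus D t := by
    ext v
    rw [mem_surplus, mem_filter_univ, excessAt_eq_outCount_sub_inCount]
    omega
  rwa [hsurplus, ← mul_add] at h

lemma excess_le_mul_card_deficit_add [DecidableEq V] (t : ℕ) :
    excess D ≤ Fintype.card V * (#(deficit D t) + t) := by
  have h := sum_toNat_le (fun v => (neg_le_abs _).trans (abs_excessAt_le D v)) t
  have hdeficit : ({v | t ≤ -excessAt D v} : Finset V) = deficit D t := by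
    ext v
    rw [mem_deficit, mem_filter_univ, excessAt_eq_outCount_sub_inCount]
    omega
  rwa [hdeficit, ← mul_add, ← excess_eq_sum_neg] at h

end Excess

section Assembly

lemma potential_le_length_add (S R : Finset V) (L : ℕ) (l : List V) :
    potential S R L l ≤ l.length + 2 * L := by
  rw [potential]
  split_ifs <;> omega

variable [DecidableEq V]

lemma startsAt_le_countP_mem (P : Multiset (List V)) (v : V) :
    startsAt P v ≤ P.countP (v ∈ ·) := by
  rw [startsAt, Multiset.countP_eq_card_filter, Multiset.countP_eq_card_filter]
  exact Multiset.card_le_card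
    (Multiset.monotone_filter_right _ fun l (hl : l.head? = some v) => List.mem_of_mem_head? hl)

lemma endsAt_le_countP_mem (P : Multiset (List V)) (v : V) :
    endsAt P v ≤ P.countP (v ∈ ·) := by
  rw [endsAt, Multiset.countP_eq_card_filter, Multiset.countP_eq_card_filter]
  exact Multiset.card_le_card
    (Multiset.monotone_filter_right _ fun l (hl : l.getLast? = some v) =>
      List.mem_of_mem_getLast? hl)

lemma startsAt_eq_zero {S : Finset V} {P : Multiset (List V)} (hP : ∀ l ∈ P, StartsIn S l) {v : V}
    (hv : v ∉ S) : startsAt P v = 0 :=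
  Nat.eq_zero_of_not_pos fun hpos => by
    obtain ⟨l, hl, hlv⟩ := startsAt_pos.1 hpos
    obtain ⟨s, hs, hls⟩ := hP l hl
    exact hv (Option.some.inj (hls.symm.trans hlv) ▸ hs)

lemma endsAt_eq_zero {R : Finset V} {P : Multiset (List V)} (hP : ∀ l ∈ P, EndsIn R l) {v : V}
    (hv : v ∉ R) : endsAt P v = 0 :=
  Nat.eq_zero_of_not_pos fun hpos => by
    obtain ⟨l, hl, hlv⟩ := endsAt_pos.1 hpos
    obtain ⟨r, hr, hlr⟩ := hP l hl
    exact hv (Option.some.inj (hlr.symm.trans hlv) ▸ hr)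

variable [Fintype V] {T : Digraph V} {t b : ℕ} {Q B : Multiset (List V)}

/-- The path family `B` starts on the surplus of `T` and ends on the deficit of `T`, with at most
`b` starts and at most `b` ends at each vertex. -/
structure IsSurplusToDeficit (T : Digraph V) (t b : ℕ) (B : Multiset (List V)) : Prop where
  startsAt_eq_zero : ∀ v ∉ surplus T t, startsAt B v = 0
  endsAt_eq_zero : ∀ v ∉ deficit T t, endsAt B v = 0
  startsAt_le : ∀ v, startsAt B v ≤ b
  endsAt_le : ∀ v, endsAt B v ≤ b

namespace IsSurplusToDeficit

lemma startsAt_pos (hB : IsSurplusToDeficit T t b B) (hbt : b < t)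
    (hQB : Decomposes (Q + B) (arcFinset T).val) {v : V} (hv : v ∈ surplus T t) :
    endsAt B v = 0 ∧ endsAt Q v < startsAt Q v := by
  have hend := hB.endsAt_eq_zero v
    (disjoint_left.1 (disjoint_surplus_deficit T (Nat.zero_lt_of_lt hbt)) hv)
  have hstart := hB.startsAt_le v
  have hcount := hQB.outCount_add_endsAt v
  rw [startsAt_add, endsAt_add] at hcount
  rw [mem_surplus] at hv
  omega

lemma endsAt_pos (hB : IsSurplusToDeficit T t b B) (hbt : b < t)
    (hQB : Decomposes (Q + B) (arcFinset T).val) {v : V} (hv : v ∈ deficit T t) :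
    startsAt B v = 0 ∧ startsAt Q v < endsAt Q v := by
  have hstart := hB.startsAt_eq_zero v
    (disjoint_right.1 (disjoint_surplus_deficit T (Nat.zero_lt_of_lt hbt)) hv)
  have hend := hB.endsAt_le v
  have hcount := hQB.outCount_add_endsAt v
  rw [startsAt_add, endsAt_add] at hcount
  rw [mem_deficit] at hv
  omega

lemma min_add_le (hB : IsSurplusToDeficit T t b B) (hbt : b < t)
    (hQB : Decomposes (Q + B) (arcFinset T).val) (v : V) :
    min (startsAt (Q + B) v) (endsAt (Q + B) v) ≤ min (startsAt Q v) (endsAt Q v) := by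
  rw [startsAt_add, endsAt_add]
  by_cases hS : v ∈ surplus T t
  · have := hB.startsAt_pos hbt hQB hS
    omega
  by_cases hR : v ∈ deficit T t
  · have := hB.endsAt_pos hbt hQB hR
    omega
  rw [hB.startsAt_eq_zero v hS, hB.endsAt_eq_zero v hR, add_zero, add_zero]

end IsSurplusToDeficit

variable {L k Δ p : ℕ} {𝒜 : Finset (Absorber V)}

lemma IsAbsorberSystem.isSurplusToDeficit
    (h : IsAbsorberSystem T (surplus T t) (deficit T t) L k Δ 𝒜) :
    IsSurplusToDeficit T t (Δ + k) (absorberPaths 𝒜) where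
  startsAt_eq_zero _ := PathDecomp.startsAt_eq_zero
    (Multiset.forall_mem_map_iff.2 fun a ha => (h.isAbsorber a ha).startsIn)
  endsAt_eq_zero _ := PathDecomp.endsAt_eq_zero
    (Multiset.forall_mem_map_iff.2 fun a ha => (h.isAbsorber a ha).endsIn)
  startsAt_le v := (startsAt_le_countP_mem _ v).trans (h.countP_mem_le v)
  endsAt_le v := (endsAt_le_countP_mem _ v).trans (h.countP_mem_le v)

lemma IsAbsorberSystem.isAbsorbing {q : ℕ} {F : Multiset (V × V)}
    (h : IsAbsorberSystem T (surplus T t) (deficit T t) L k Δ 𝒜)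
    (hcentre : ∀ x, #{a ∈ 𝒜 | a.centre = x} = k) (hΔt : Δ + k < t) (hQ : Decomposes Q F)
    (hF : F + arcsOf (absorberPaths 𝒜) = (arcFinset T).val) (hlength : ∀ l ∈ Q, l.length ≤ p)
    (hmin : ∀ v, min (startsAt Q v) (endsAt Q v) ≤ q) (hk : q + 2 * (p + 2 * L) ≤ k) :
    IsAbsorbing (surplus T t) (deficit T t) L (p + 2 * L) Q 𝒜 := by
  have hB := h.isSurplusToDeficit
  have hQB : Decomposes (Q + absorberPaths 𝒜) (arcFinset T).val := hF ▸ hQ.add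
    (decomposes_absorberPaths (disjoint_surplus_deficit T (Nat.zero_lt_of_lt hΔt)) h.isAbsorber)
  refine ⟨hQ.two_le_length, hQ.nodup, fun l hl => ?_, h.isAbsorber, h.pairwiseDisjoint,
    fun x hx => ?_, fun x hx => ?_, fun x => ?_⟩
  · exact (potential_le_length_add ..).trans (Nat.add_le_add_right (hlength l hl) _)
  · exact Nat.zero_lt_of_lt (hB.startsAt_pos hΔt hQB hx).2
  · exact Nat.zero_lt_of_lt (hB.endsAt_pos hΔt hQB hx).2
  · have := hB.min_add_le hΔt hQB x
    have := hmin x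
    rw [hcentre]
    omega

end Assembly

theorem hasPerfectDecomposition_of_parameters [Fintype V] {T : Digraph V} {L k Δ p t τ c : ℕ}
    [Fact p.Prime] (hT : IsTournament T) (hp : p ≠ 2) (hΔ : 0 < Δ) (hΔt : Δ + k < t)
    (hLk : 2 * L * k * Fintype.card V ≤ Δ ^ 2) (hL : Fintype.card V ≤ 2 ^ L)
    (hexcess : Fintype.card V * (t + 2 * ((Δ + k) + (Δ + k * (2 * L) + L)) + 1 + t) < excess T)
    (hτ : 4 * (Fintype.card V * p : ℝ) < Real.exp (2 * τ ^ 2 / Fintype.card V))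
    (hc : Fintype.card V + p * τ ≤ p * c)
    (hk : p * (2 * τ) + 3 * c + 2 * (p + 2 * L) ≤ k) : HasPerfectDecomposition T := by
  classical
  have hS := Nat.lt_of_mul_lt_mul_left (hexcess.trans_le (excess_le_mul_card_surplus_add T t))
  have hR := Nat.lt_of_mul_lt_mul_left (hexcess.trans_le (excess_le_mul_card_deficit_add T t))
  have ht := Nat.zero_lt_of_lt hΔt
  obtain ⟨𝒜, h𝒜, hcentre⟩ := exists_isAbsorberSystem hT ht hΔ hLk hL (Nat.lt_of_add_lt_add_right hS)
    (Nat.lt_of_add_lt_add_right hR)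
  set F := arcFinset T \ (arcsOf (absorberPaths 𝒜)).toFinset with hFdef
  have hF : F.val + arcsOf (absorberPaths 𝒜) = (arcFinset T).val := by
    rw [hFdef, sdiff_val, Multiset.toFinset_val,
      (Multiset.nodup_of_le h𝒜.arcsOf_le (arcFinset T).nodup).dedup,
      tsub_add_cancel_of_le h𝒜.arcsOf_le]
  have hloopless : ∀ e ∈ F, e.1 ≠ e.2 := fun e he heq =>
    hT.1 e.1 (by simpa [← heq] using mem_arcFinset.1 (sdiff_subset he))
  obtain ⟨f, hf⟩ := exists_isBalancedColouring (ι := ZMod p) F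
    (by simpa using hτ) (by simpa using hc)
  obtain ⟨Q, hQ, hlength, hmin⟩ := exists_decomposes_of_isBalancedColouring hp hloopless hf
  obtain ⟨P, hP, hstart_end⟩ := (h𝒜.isAbsorbing hcentre hΔt hQ hF hlength hmin hk).exists_decomposes
    (disjoint_surplus_deficit T ht)
  rw [arcsOf_add, hQ.arcsOf_eq, hF] at hP
  exact hP.hasPerfectDecomposition hstart_end

section Parameters

variable {n p k m L : ℕ}

lemma four_mul_lt_exp (hn : 0 < n) (hL : 0 < L) (hp : 4 * p ≤ n) (hnL : n ≤ 2 ^ L)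
    (hnm : n ≤ 2 ^ 8 * m ^ 8) :
    4 * (n * p : ℝ) < Real.exp (2 * (16 * m ^ 4 * L : ℕ) ^ 2 / n) := by
  have hpow : 4 * (n * p) ≤ 2 ^ (2 * L) := calc
    4 * (n * p) = n * (4 * p) := by ring
    _ ≤ 2 ^ L * 2 ^ L := Nat.mul_le_mul hnL (hp.trans hnL)
    _ = 2 ^ (2 * L) := by ring
  have hexponent : 2 * L * n ≤ 2 * (16 * m ^ 4 * L) ^ 2 := calc
    2 * L * n ≤ 2 * L * (2 ^ 8 * m ^ 8) := Nat.mul_le_mul_left _ hnm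
    _ = 2 * 2 ^ 8 * m ^ 8 * L := by ring
    _ ≤ 2 * 2 ^ 8 * m ^ 8 * (L * L) := Nat.mul_le_mul_left _ (Nat.le_mul_self L)
    _ = 2 * (16 * m ^ 4 * L) ^ 2 := by ring
  calc (4 * (n * p) : ℝ) ≤ 2 ^ (2 * L) := by exact_mod_cast hpow
    _ < Real.exp 1 ^ (2 * L) :=
      pow_lt_pow_left₀ (by linarith [Real.exp_one_gt_d9]) (by norm_num) (by omega)
    _ = Real.exp (2 * L : ℕ) := Real.exp_one_pow _
    _ ≤ Real.exp (2 * (16 * m ^ 4 * L : ℕ) ^ 2 / n) :=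
      Real.exp_le_exp.2 ((le_div_iff₀ (Nat.cast_pos.2 hn)).2 (by exact_mod_cast hexponent))

lemma absorption_cost_lt (hL : 0 < L) (hLm : 32 * L ≤ m) (hLk : L ≤ k) :
    (m * k + k + 1) + 2 * ((m * k + k) + (m * k + k * (2 * L) + L)) + 1 + (m * k + k + 1) <
      8 * (m * k) := by
  have hkL : 32 * (k * L) ≤ m * k := by linarith [Nat.mul_le_mul_left k hLm]
  have hk : k ≤ k * L := Nat.le_mul_of_pos_right k hL
  linarith

lemma splitting_cost_le (hm : 0 < m) (hL : 0 < L) (hpm : p ≤ 2 * m ^ 2) :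
    p * (2 * (16 * m ^ 4 * L)) + 3 * (2 ^ 8 * m ^ 6 + 16 * m ^ 4 * L) + 2 * (p + 2 * L) ≤
      2 ^ 10 * m ^ 6 * L := by
  have hpτ : p * (2 * (16 * m ^ 4 * L)) ≤ 64 * (m ^ 6 * L) := calc
    p * (2 * (16 * m ^ 4 * L)) ≤ 2 * m ^ 2 * (2 * (16 * m ^ 4 * L)) := Nat.mul_le_mul_right _ hpm
    _ = 64 * (m ^ 6 * L) := by ring
  have hm6 : m ^ 6 ≤ m ^ 6 * L := Nat.le_mul_of_pos_right _ hL
  have hm4L : m ^ 4 * L ≤ m ^ 6 * L :=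
    Nat.mul_le_mul_right L (Nat.pow_le_pow_right hm (by norm_num))
  have hm2 : m ^ 2 ≤ m ^ 6 := Nat.pow_le_pow_right hm (by norm_num)
  have hLm : L ≤ m ^ 6 * L := Nat.le_mul_of_pos_left L (Nat.pow_pos hm)
  linarith

lemma natLog_succ_le_log (hn : 1 < n) : ((Nat.log 2 n + 1 : ℕ) : ℝ) ≤ 4 * Real.log n := by
  have hlogn : Real.log 2 ≤ Real.log n := Real.log_le_log two_pos (by exact_mod_cast hn)
  have hfloor : Nat.log 2 n * Real.log 2 ≤ Real.log n :=
    (le_div_iff₀ (Real.log_pos one_lt_two)).1 (Real.natLog_le_logb n 2)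
  push_cast
  nlinarith [Real.log_two_gt_d9]

lemma eventually_rpow_mul_log_le_rpow {a b : ℝ} (hab : b < a) {C : ℝ} (hC : 0 < C) :
    ∀ᶠ x : ℝ in Filter.atTop, C * x ^ b * Real.log x ≤ x ^ a := by
  have hlog := (isLittleO_log_rpow_atTop (sub_pos.2 hab)).bound (inv_pos.2 hC)
  filter_upwards [hlog, Filter.eventually_gt_atTop 0] with x hx hx0
  calc C * x ^ b * Real.log x ≤ C * x ^ b * (C⁻¹ * x ^ (a - b)) := by
        gcongr
        simpa [abs_of_pos (Real.rpow_pos_of_pos hx0 _)] using (le_abs_self _).trans hx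
    _ = x ^ b * x ^ (a - b) := by field_simp
    _ = x ^ a := by rw [← Real.rpow_add hx0, add_sub_cancel]

variable [Fintype V] {T : Digraph V}

lemma excess_le_sq_card (D : Digraph V) : excess D ≤ Fintype.card V ^ 2 := by
  classical
  rw [sq]
  exact (excess_le_mul_card_surplus_add D 0).trans (Nat.mul_le_mul_left _ (card_le_univ _))

lemma mul_le_of_mul_le_excess (hm : 0 < m) (hn : 0 < Fintype.card V)
    (hnm : Fintype.card V ≤ 2 ^ 8 * m ^ 8)
    (hexcess : 2 ^ 13 * Fintype.card V * m ^ 7 * L ≤ excess T) : 32 * L ≤ m := by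
  set n := Fintype.card V
  have hle : n * (2 ^ 8 * m ^ 7) * (32 * L) ≤ n * (2 ^ 8 * m ^ 7) * m := calc
    n * (2 ^ 8 * m ^ 7) * (32 * L) = 2 ^ 13 * n * m ^ 7 * L := by ring
    _ ≤ n ^ 2 := hexcess.trans (excess_le_sq_card T)
    _ ≤ n * (2 ^ 8 * m ^ 8) := sq n ▸ Nat.mul_le_mul_left n hnm
    _ = n * (2 ^ 8 * m ^ 7) * m := by ring
  exact Nat.le_of_mul_le_mul_left hle (by positivity)

theorem hasPerfectDecomposition_of_mul_le_excess (hT : IsTournament T) (hm : 0 < m) (hL : 0 < L)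
    (hmn : m ^ 8 ≤ Fintype.card V) (hnm : Fintype.card V ≤ 2 ^ 8 * m ^ 8)
    (hnL : Fintype.card V ≤ 2 ^ L)
    (hexcess : 2 ^ 13 * Fintype.card V * m ^ 7 * L ≤ excess T) : HasPerfectDecomposition T := by
  set n := Fintype.card V
  have hn : 0 < n := (Nat.pow_pos hm).trans_le hmn
  have hLm : 32 * L ≤ m := mul_le_of_mul_le_excess hm hn hnm hexcess
  obtain ⟨p, hp, hmp, hpm⟩ := Nat.exists_prime_lt_and_le_two_mul (m ^ 2) (Nat.pow_pos hm).ne'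
  have : Fact p.Prime := ⟨hp⟩
  have hpn : 4 * p ≤ n := calc
    4 * p ≤ m * m ^ 2 := by nlinarith
    _ = m ^ 3 := by ring
    _ ≤ n := (Nat.pow_le_pow_right hm (by norm_num)).trans hmn
  have hLk : L ≤ 2 ^ 10 * m ^ 6 * L := Nat.le_mul_of_pos_left L (by positivity)
  refine hasPerfectDecomposition_of_parameters (p := p) (L := L) (k := 2 ^ 10 * m ^ 6 * L)
    (Δ := m * (2 ^ 10 * m ^ 6 * L)) (τ := 16 * m ^ 4 * L) (c := 2 ^ 8 * m ^ 6 + 16 * m ^ 4 * L) hT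
    (by nlinarith) (by positivity) (Nat.lt_succ_self _) ?_ hnL ?_
    (four_mul_lt_exp hn hL hpn hnL hnm) ?_ (splitting_cost_le hm hL hpm)
  · calc 2 * L * (2 ^ 10 * m ^ 6 * L) * n
        ≤ 2 * L * (2 ^ 10 * m ^ 6 * L) * (2 ^ 8 * m ^ 8) := Nat.mul_le_mul_left _ hnm
      _ = 2 ^ 19 * m ^ 14 * L ^ 2 := by ring
      _ ≤ 2 ^ 20 * m ^ 14 * L ^ 2 := by gcongr <;> norm_num
      _ = (m * (2 ^ 10 * m ^ 6 * L)) ^ 2 := by ring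
  · calc _ < n * (8 * (m * (2 ^ 10 * m ^ 6 * L))) :=
          Nat.mul_lt_mul_of_pos_left (absorption_cost_lt hL hLm hLk) hn
      _ = 2 ^ 13 * n * m ^ 7 * L := by ring
      _ ≤ excess T := hexcess
  · calc n + p * (16 * m ^ 4 * L) ≤ m ^ 2 * (2 ^ 8 * m ^ 6) + p * (16 * m ^ 4 * L) := by
          linarith [hnm]
      _ ≤ p * (2 ^ 8 * m ^ 6) + p * (16 * m ^ 4 * L) := by gcongr
      _ = p * (2 ^ 8 * m ^ 6 + 16 * m ^ 4 * L) := by ring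

theorem hasPerfectDecomposition_of_rpow_mul_log_le_excess (hT : IsTournament T)
    (hV : 1 < Fintype.card V)
    (hexcess : 2 ^ 15 * (Fintype.card V : ℝ) ^ (15 / 8 : ℝ) * Real.log (Fintype.card V) ≤
      excess T) : HasPerfectDecomposition T := by
  set n := Fintype.card V
  have hmn : Nat.nthRoot 8 n ^ 8 ≤ n := Nat.pow_nthRoot_le_iff.2 (Or.inl (by norm_num))
  have hm : 0 < Nat.nthRoot 8 n := (Nat.le_nthRoot_iff (by norm_num)).2 (by norm_num; omega)
  generalize hmdef : Nat.nthRoot 8 n = m at hmn hm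
  have hnm : n ≤ 2 ^ 8 * m ^ 8 := calc
    n ≤ (m + 1) ^ 8 := hmdef ▸ (Nat.lt_pow_nthRoot_add_one (by norm_num) n).le
    _ ≤ (2 * m) ^ 8 := Nat.pow_le_pow_left (by omega) 8
    _ = 2 ^ 8 * m ^ 8 := mul_pow 2 m 8
  refine hasPerfectDecomposition_of_mul_le_excess hT hm (Nat.succ_pos (Nat.log 2 n)) hmn hnm
    (Nat.lt_pow_succ_log_self one_lt_two n).le ?_
  have hroot : (m : ℝ) ^ 7 ≤ (n : ℝ) ^ (7 / 8 : ℝ) := calc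
    (m : ℝ) ^ 7 = ((m : ℝ) ^ 8) ^ (7 / 8 : ℝ) := by
      rw [← Real.rpow_natCast_mul m.cast_nonneg, ← Real.rpow_natCast]; norm_num
    _ ≤ (n : ℝ) ^ (7 / 8 : ℝ) := by gcongr; exact_mod_cast hmn
  have hlog : ((Nat.log 2 n + 1 : ℕ) : ℝ) ≤ 4 * Real.log n := natLog_succ_le_log hV
  have hbound := calc
    (2 ^ 13 * n * m ^ 7 * (Nat.log 2 n + 1 : ℕ) : ℝ)
        ≤ 2 ^ 13 * n * (n : ℝ) ^ (7 / 8 : ℝ) * (4 * Real.log n) := by gcongr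
    _ = 2 ^ 15 * (n : ℝ) ^ (15 / 8 : ℝ) * Real.log n := by
      rw [show (15 / 8 : ℝ) = 1 + 7 / 8 by norm_num, Real.rpow_one_add' n.cast_nonneg (by norm_num)]
      ring
    _ ≤ excess T := hexcess
  exact_mod_cast hbound

end Parameters

end PathDecomp

theorem mainTheorem2_general (a : ℝ) (ha : 15 / 8 < a) :
    ∃ n₀ : ℕ, ∀ (V : Type u) [Fintype V] (T : Digraph V),
      PathDecomp.IsTournament T → n₀ ≤ Fintype.card V →
      (Fintype.card V : ℝ) ^ a ≤ (PathDecomp.excess T : ℝ) →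
      PathDecomp.HasPerfectDecomposition T := by
  have hlarge := tendsto_natCast_atTop_atTop.eventually
    (PathDecomp.eventually_rpow_mul_log_le_rpow ha (C := 2 ^ 15) (by norm_num))
  obtain ⟨n₀, hn₀⟩ := Filter.eventually_atTop.1 (hlarge.and (Filter.eventually_gt_atTop 1))
  refine ⟨n₀, fun V _ T hT hV hexcess => ?_⟩
  obtain ⟨hle, hcard⟩ := hn₀ _ hV
  exact PathDecomp.hasPerfectDecomposition_of_rpow_mul_log_le_excess hT hcard (hle.trans hexcess)

theorem mainTheorem2 :
    (∀ γ : ℝ, 0 < γ → ∃ n₀ : ℕ, ∀ (V : Type u) [Fintype V] (T : Digraph V),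
      PathDecomp.IsTournament T → n₀ ≤ Fintype.card V →
      8 * (Fintype.card V : ℝ) ^ ((17 / 9 : ℝ) + γ) ≤ (PathDecomp.excess T : ℝ) →
      PathDecomp.HasPerfectDecomposition T) ∧
    (∃ n₀ : ℕ, ∀ (V : Type u) [Fintype V] (T : Digraph V),
      PathDecomp.IsTournament T → n₀ < Fintype.card V → Even (Fintype.card V) →
      (Fintype.card V : ℝ) ^ ((2 : ℝ) - 1 / 18) ≤ (PathDecomp.excess T : ℝ) →
      PathDecomp.pathNumber T = PathDecomp.excess T) := by
  constructor
  · intro γ hγ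
    obtain ⟨n₀, hn₀⟩ := mainTheorem2_general (17 / 9 + γ) (by linarith)
    refine ⟨n₀, fun V _ T hT hV hexcess => hn₀ V T hT hV (le_trans ?_ hexcess)⟩
    exact le_mul_of_one_le_left (by positivity) (by norm_num)
  · obtain ⟨n₀, hn₀⟩ := mainTheorem2_general (2 - 1 / 18) (by norm_num)
    exact ⟨n₀, fun V _ T hT hV _ hexcess =>
      PathDecomp.pathNumber_eq_excess hT.1 (hn₀ V T hT hV.le hexcess)⟩
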